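/- **Theorem (generating function for two-row multiparameter Schur $P$-functions).** Let $a=(a_k)_{k\ge1}$ be a sequence of complex numbers with $a_1=0$, and put $(x|a)^k=\prod_{i=1}^k(x-a_i)$. Let $\Gamma$ be the algebra of supersymmetric functions over $\mathbb C$: its elements are the sequences $(f_n)$ of polynomials $f_n\in\mathbb C[x_1,\dots,x_n]$ such that each $f_n$ is symmetric, each $f_n(\dots,t,\dots,-t,\dots)$ (with $t$ in position $i$ and $-t$ in position $j$, $i<j$) does not depend on $t$, $f_{n+1}(x_1,\dots,x_n,0)=f_n(x_1,\dots,x_n)$ for all $n$, and the degrees $\deg f_n$ are bounded. For a strict partition $\lambda=(\lambda_1>\dots>\lambda_\ell>0)$ let $P_{\lambda;a}\in\Gamma$ be the multiparameter Schur $P$-function, whose $n$-variable component is $$P_{\lambda;a}(x_1,\dots,x_n)=\frac1{(n-\ell)!}\sum_{\omega\in S(n)}\ \prod_{i=1}^{\ell}(x_{\omega(i)}|a)^{\lambda_i}\prod_{i\le \ell,\ i<j\le n}\frac{x_{\omega(i)}+x_{\omega(j)}}{x_{\omega(i)}-x_{\omega(j)}}$$ if $\ell\le n$, and $0$ if $\ell>n$.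 For integers $k>l\ge0$ let $P_{(k,l);a}$ be $P_{\lambda;a}$ with $\lambda=(k,l)$ (that is, $\lambda=(k)$ if $l=0$), and for $0\le k\le l$ put $P_{(k,l);a}=-P_{(l,k);a}$; in particular $P_{(k,k);a}=0$ for all $k\ge0$. Then $$4uv(u+v)\sum_{k,l\ge0}\frac{P_{(k,l);a}(x_1,x_2,\dots)}{(u|a)^{k+1}(v|a)^{l+1}} = u\Bigl(\prod_{j=1}^\infty\frac{u+x_j}{u-x_j}+1\Bigr)\Bigl(-\prod_{j=1}^\infty\frac{v+x_j}{v-x_j}+1\Bigr) - v\Bigl(-\prod_{j=1}^\infty\frac{u+x_j}{u-x_j}+1\Bigr)\Bigl(\prod_{j=1}^\infty\frac{v+x_j}{v-x_j}+1\Bigr).$$ This is an identity of formal Laurent series in $u^{-1}$ and $v^{-1}$ with coefficients in $\Gamma$: the fractions $1/(u|a)^{k+1}$, $1/(v|a)^{l+1}$ and the products are expanded in powers of $u^{-1}$ and $v^{-1}$, and for every monomial in $u$ and $v$ only finitely many terms of the double sum contribute to its coefficient. -/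

import Mathlib

namespace MultiSchur

noncomputable section

open MvPolynomial

/-- The generalized power `(x | a)^k = (x - a₁)(x - a₂)⋯(x - aₖ)`.  The sequence is indexed from
`1`; the value `a 0` is never used. -/
def genPow {A : Type*} [CommRing A] [Algebra ℂ A] (a : ℕ → ℂ) (x : A) (k : ℕ) : A :=
  ∏ i ∈ Finset.Icc 1 k, (x - algebraMap ℂ A (a i))

/-- A strict partition: a strictly decreasing finite list of positive integers. -/
structure StrictPartition where
  parts : List ℕ
  sorted : parts.Pairwise (· > ·)
  pos : ∀ p ∈ parts, 0 < p

/-- `∏_{i ≤ l} (y_i | a)^{lam_i} · ∏_{i ≤ l, i < j ≤ n} (y_i + y_j) / (y_i - y_j)`. -/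
def schurTerm {K : Type*} [Field K] [Algebra ℂ K] (a : ℕ → ℂ) {l n : ℕ} (h : l ≤ n)
    (lam : Fin l → ℕ) (y : Fin n → K) : K :=
  (∏ i : Fin l, genPow a (y (Fin.castLE h i)) (lam i)) *
    ∏ i : Fin l, ∏ j ∈ Finset.Ioi (Fin.castLE h i),
      (y (Fin.castLE h i) + y j) / (y (Fin.castLE h i) - y j)

/-- The symmetrization `1 / (n - l)! · ∑_{ω ∈ S(n)}` of `schurTerm`, in a field `K`; it is `0`
if `l > n`. -/
def schurSum {K : Type*} [Field K] [Algebra ℂ K] (a : ℕ → ℂ) {l : ℕ} (n : ℕ)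
    (lam : Fin l → ℕ) (y : Fin n → K) : K :=
  if h : l ≤ n then
    (((n - l).factorial : ℕ) : K)⁻¹ * ∑ ω : Equiv.Perm (Fin n), schurTerm a h lam (fun i => y (ω i))
  else 0

/-- `f(x₁, …, xₙ)` is supersymmetric: it is symmetric, and for `i < j` the substitution
`x_i = t, x_j = -t` gives a polynomial that does not depend on `t` (the variable `x_i` plays
the role of `t`, and the result is compared with the one for `t = 0`). -/
def IsSupersymmetric {n : ℕ} (f : MvPolynomial (Fin n) ℂ) : Prop :=
  f.IsSymmetric ∧ ∀ i j : Fin n, i < j →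
    aeval (Function.update X j (-X i) : Fin n → MvPolynomial (Fin n) ℂ) f =
      aeval (Function.update (Function.update X i 0) j 0 : Fin n → MvPolynomial (Fin n) ℂ) f

/-- The specialization `x_{n+1} = 0`. -/
def proj (n : ℕ) : MvPolynomial (Fin (n + 1)) ℂ →ₐ[ℂ] MvPolynomial (Fin n) ℂ :=
  aeval (Fin.snoc (α := fun _ => MvPolynomial (Fin n) ℂ) X 0)

/-- The algebra `Γ` of supersymmetric functions: stable sequences `(fₙ)` of supersymmetric
polynomials of bounded degree (`f₀` is determined by `f₁`). -/
def Gamma : Subalgebra ℂ (∀ n : ℕ, MvPolynomial (Fin n) ℂ) where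
  carrier := {f | (∀ n, IsSupersymmetric (f n)) ∧ (∀ n, proj n (f (n + 1)) = f n) ∧
    ∃ d : ℕ, ∀ n, (f n).totalDegree ≤ d}
  mul_mem' := by
    rintro f g ⟨hf1, hf2, d, hf3⟩ ⟨hg1, hg2, e, hg3⟩
    refine ⟨fun n => ⟨(hf1 n).1.mul (hg1 n).1, fun i j hij => ?_⟩, fun n => ?_, d + e, fun n => ?_⟩
    · simp only [Pi.mul_apply, map_mul, (hf1 n).2 i j hij, (hg1 n).2 i j hij]
    · simp only [Pi.mul_apply, map_mul, hf2, hg2]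
    · exact (totalDegree_mul _ _).trans (add_le_add (hf3 n) (hg3 n))
  add_mem' := by
    rintro f g ⟨hf1, hf2, d, hf3⟩ ⟨hg1, hg2, e, hg3⟩
    refine ⟨fun n => ⟨(hf1 n).1.add (hg1 n).1, fun i j hij => ?_⟩, fun n => ?_, max d e,
      fun n => ?_⟩
    · simp only [Pi.add_apply, map_add, (hf1 n).2 i j hij, (hg1 n).2 i j hij]
    · simp only [Pi.add_apply, map_add, hf2, hg2]
    · exact (totalDegree_add _ _).trans (max_le_max (hf3 n) (hg3 n))
  algebraMap_mem' := by
    intro r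
    refine ⟨fun n => ⟨?_, fun i j hij => ?_⟩, fun n => ?_, 0, fun n => ?_⟩
    · exact (symmetricSubalgebra (Fin n) ℂ).algebraMap_mem r
    · simp only [Pi.algebraMap_apply, AlgHom.commutes]
    · simp only [Pi.algebraMap_apply, AlgHom.commutes]
    · simp [Pi.algebraMap_apply, algebraMap_eq]

/-! ### Polynomiality -/

theorem genPow_map {A B : Type*} [CommRing A] [Algebra ℂ A] [CommRing B] [Algebra ℂ B]
    (φ : A →ₐ[ℂ] B) (a : ℕ → ℂ) (x : A) (k : ℕ) : genPow a (φ x) k = φ (genPow a x k) := by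
  simp [genPow, map_prod]

theorem genPow_zero_left {A : Type*} [CommRing A] [Algebra ℂ A] {a : ℕ → ℂ} (ha : a 1 = 0)
    {k : ℕ} (hk : 0 < k) : genPow a (0 : A) k = 0 := by
  apply Finset.prod_eq_zero (i := 1)
  · simp; omega
  · simp [ha]

/-- The Vandermonde product `∏_{i < j} (y_i - y_j)`. -/
def vdm {A : Type*} [CommRing A] {n : ℕ} (y : Fin n → A) : A :=
  ∏ i, ∏ j ∈ Finset.Ioi i, (y i - y j)

/-- `schurTerm`, multiplied by the Vandermonde product. -/
def numTerm {A : Type*} [CommRing A] [Algebra ℂ A] (a : ℕ → ℂ) {l n : ℕ} (h : l ≤ n)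
    (lam : Fin l → ℕ) (y : Fin n → A) : A :=
  (∏ i : Fin l, genPow a (y (Fin.castLE h i)) (lam i)) *
    ∏ i, ∏ j ∈ Finset.Ioi i, (if i.val < l then y i + y j else y i - y j)

/-- The symmetrization of `schurTerm`, multiplied by the Vandermonde product. -/
def numSum {A : Type*} [CommRing A] [Algebra ℂ A] (a : ℕ → ℂ) {l n : ℕ} (h : l ≤ n)
    (lam : Fin l → ℕ) (y : Fin n → A) : A :=
  ∑ ω : Equiv.Perm (Fin n), ((Equiv.Perm.sign ω : ℤ) : A) * numTerm a h lam (fun i => y (ω i))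

theorem vdm_perm {A : Type*} [CommRing A] {n : ℕ} (y : Fin n → A) (σ : Equiv.Perm (Fin n)) :
    vdm (fun i => y (σ i)) = ((Equiv.Perm.sign σ : ℤ) : A) * vdm y :=
  σ.prod_Ioi_comp_eq_sign_mul_prod (f := fun i j => y i - y j) (fun i j => by ring)

theorem vdm_ne_zero {K : Type*} [Field K] {n : ℕ} {y : Fin n → K} (hy : Function.Injective y) :
    vdm y ≠ 0 := by
  refine Finset.prod_ne_zero_iff.2 fun i _ => Finset.prod_ne_zero_iff.2 fun j hj => ?_
  exact sub_ne_zero.2 fun h => (Finset.mem_Ioi.1 hj).ne (hy h)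

theorem vdm_map {A B : Type*} [CommRing A] [Algebra ℂ A] [CommRing B] [Algebra ℂ B]
    (φ : A →ₐ[ℂ] B) {n : ℕ} (y : Fin n → A) : vdm (fun i => φ (y i)) = φ (vdm y) := by
  simp [vdm, map_prod]

theorem numTerm_map {A B : Type*} [CommRing A] [Algebra ℂ A] [CommRing B] [Algebra ℂ B]
    (φ : A →ₐ[ℂ] B) (a : ℕ → ℂ) {l n : ℕ} (h : l ≤ n) (lam : Fin l → ℕ) (y : Fin n → A) :
    numTerm a h lam (fun i => φ (y i)) = φ (numTerm a h lam y) := by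
  simp only [numTerm, map_prod, map_mul, genPow_map, apply_ite φ, map_add, map_sub]

theorem numSum_map {A B : Type*} [CommRing A] [Algebra ℂ A] [CommRing B] [Algebra ℂ B]
    (φ : A →ₐ[ℂ] B) (a : ℕ → ℂ) {l n : ℕ} (h : l ≤ n) (lam : Fin l → ℕ) (y : Fin n → A) :
    numSum a h lam (fun i => φ (y i)) = φ (numSum a h lam y) := by
  simp only [numSum, map_sum, map_mul, map_intCast]
  exact Finset.sum_congr rfl fun ω _ => by rw [← numTerm_map]

theorem numSum_perm {A : Type*} [CommRing A] [Algebra ℂ A] (a : ℕ → ℂ) {l n : ℕ} (h : l ≤ n)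
    (lam : Fin l → ℕ) (y : Fin n → A) (σ : Equiv.Perm (Fin n)) :
    numSum a h lam (fun i => y (σ i)) = ((Equiv.Perm.sign σ : ℤ) : A) * numSum a h lam y := by
  rw [numSum, numSum, Finset.mul_sum]
  conv_rhs => rw [← Equiv.sum_comp (Equiv.mulLeft σ)]
  refine Finset.sum_congr rfl fun ω _ => ?_
  simp only [Equiv.coe_mulLeft, Equiv.Perm.mul_apply, Equiv.Perm.sign_mul]
  rw [← mul_assoc, ← Int.cast_mul, ← Units.val_mul, ← mul_assoc, Int.units_mul_self, one_mul]

theorem numTerm_div {K : Type*} [Field K] [Algebra ℂ K] (a : ℕ → ℂ) {l n : ℕ} (h : l ≤ n)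
    (lam : Fin l → ℕ) {y : Fin n → K} (hy : Function.Injective y) :
    numTerm a h lam y = vdm y * schurTerm a h lam y := by
  obtain ⟨m, rfl⟩ := Nat.exists_eq_add_of_le h
  have key : ∏ i : Fin (l + m), ∏ j ∈ Finset.Ioi i,
      (if i.val < l then y i + y j else y i - y j) =
      vdm y * ∏ i : Fin l, ∏ j ∈ Finset.Ioi (Fin.castLE h i),
        (y (Fin.castLE h i) + y j) / (y (Fin.castLE h i) - y j) := by
    rw [vdm, Fin.prod_univ_add, Fin.prod_univ_add]
    rw [mul_right_comm, ← Finset.prod_mul_distrib]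
    congr 1
    · refine Finset.prod_congr rfl fun i _ => ?_
      rw [show Fin.castLE h i = Fin.castAdd m i from rfl, ← Finset.prod_mul_distrib]
      refine Finset.prod_congr rfl fun j hj => ?_
      have : y (Fin.castAdd m i) - y j ≠ 0 :=
        sub_ne_zero.2 fun h => (Finset.mem_Ioi.1 hj).ne (hy h)
      simp only [Fin.val_castAdd, i.isLt, if_true]
      field_simp
    · refine Finset.prod_congr rfl fun i _ => Finset.prod_congr rfl fun j _ => ?_
      simp
  rw [numTerm, schurTerm, key]
  ring

theorem numSum_div {K : Type*} [Field K] [Algebra ℂ K] (a : ℕ → ℂ) {l n : ℕ} (h : l ≤ n)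
    (lam : Fin l → ℕ) {y : Fin n → K} (hy : Function.Injective y) :
    numSum a h lam y = vdm y * ∑ ω : Equiv.Perm (Fin n), schurTerm a h lam (fun i => y (ω i)) := by
  rw [numSum, Finset.mul_sum]
  refine Finset.sum_congr rfl fun ω _ => ?_
  rw [numTerm_div a h lam (y := fun i => y (ω i)) (hy.comp ω.injective), vdm_perm, ← mul_assoc,
    ← mul_assoc, ← Int.cast_mul, ← Units.val_mul, Int.units_mul_self]
  simp

theorem X_sub_X_dvd {n : ℕ} (i j : Fin n) {f : MvPolynomial (Fin n) ℂ}
    (hf : aeval (Function.update X j (X i) : Fin n → MvPolynomial (Fin n) ℂ) f = 0) :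
    (X i - X j) ∣ f := by
  rw [← Ideal.mem_span_singleton, ← Ideal.Quotient.eq_zero_iff_mem]
  set I : Ideal (MvPolynomial (Fin n) ℂ) := Ideal.span {X i - X j}
  have : (Ideal.Quotient.mkₐ ℂ I).comp
      (aeval (Function.update X j (X i) : Fin n → MvPolynomial (Fin n) ℂ)) =
      Ideal.Quotient.mkₐ ℂ I := by
    refine MvPolynomial.algHom_ext fun k => ?_
    by_cases hk : k = j
    · subst hk
      simp only [AlgHom.comp_apply, aeval_X, Function.update_self, Ideal.Quotient.mkₐ_eq_mk]
      exact Ideal.Quotient.eq.2 (Ideal.mem_span_singleton_self _)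
    · simp [Function.update_of_ne hk]
  have h2 := DFunLike.congr_fun this f
  rw [AlgHom.comp_apply, hf, map_zero] at h2
  exact h2.symm

theorem X_sub_X_irreducible {n : ℕ} {i j : Fin n} (hij : i ≠ j) :
    Irreducible (X i - X j : MvPolynomial (Fin n) ℂ) := by
  have hc : (X i - X j : MvPolynomial (Fin n) ℂ).coeff (Finsupp.single i 1) = 1 := by
    simp [coeff_X, Finsupp.single_left_inj, hij.symm]
  apply irreducible_of_totalDegree_eq_one
  · apply le_antisymm
    · exact (totalDegree_sub _ _).trans (by simp)
    · have := le_totalDegree (p := (X i - X j : MvPolynomial (Fin n) ℂ))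
        (s := Finsupp.single i 1) (by rw [mem_support_iff, hc]; exact one_ne_zero)
      simpa using this
  · intro x hx
    exact isUnit_of_dvd_one (hc ▸ hx (Finsupp.single i 1))

theorem vdm_dvd_numSum (a : ℕ → ℂ) {l n : ℕ} (h : l ≤ n) (lam : Fin l → ℕ) :
    vdm (X : Fin n → MvPolynomial (Fin n) ℂ) ∣
      numSum a h lam (X : Fin n → MvPolynomial (Fin n) ℂ) := by
  rw [vdm, Finset.prod_sigma']
  apply Finset.prod_dvd_of_isRelPrime
  · rintro ⟨i, j⟩ hij ⟨i', j'⟩ hij' hne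
    simp only [Finset.coe_sigma, Set.mem_sigma_iff, Finset.mem_coe,
      Finset.coe_univ, Set.mem_univ, true_and, Finset.mem_Ioi] at hij hij'
    refine (X_sub_X_irreducible hij.ne).isRelPrime_iff_not_dvd.2 fun hd => ?_
    have ev : ∀ c : Fin n → ℂ, c i = c j → c i' = c j' := fun c hc => by
      have := map_dvd (aeval c) hd
      simp only [map_sub, aeval_X, hc, sub_self, zero_dvd_iff] at this
      exact sub_eq_zero.1 this
    have key : ∀ k, k ≠ i → k ≠ j → k ≠ i' ∧ k ≠ j' := by
      intro k hi hj
      have := ev (Pi.single k 1) (by simp [hi.symm, hj.symm])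
      constructor
      · rintro rfl
        simp [hij'.ne'] at this
      · rintro rfl
        simp [hij'.ne] at this
    apply hne
    have h1 : i' = i ∨ i' = j := by
      by_contra hcon
      push Not at hcon
      exact (key i' hcon.1 hcon.2).1 rfl
    have h2 : j' = i ∨ j' = j := by
      by_contra hcon
      push Not at hcon
      exact (key j' hcon.1 hcon.2).2 rfl
    have : i' = i ∧ j' = j := by omega
    rw [this.1, this.2]
  · rintro ⟨i, j⟩ hij
    simp only [Finset.mem_sigma, Finset.mem_univ, true_and, Finset.mem_Ioi] at hij
    apply X_sub_X_dvd
    rw [← numSum_map]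
    set y : Fin n → MvPolynomial (Fin n) ℂ :=
      fun k => aeval (Function.update X j (X i) : Fin n → MvPolynomial (Fin n) ℂ)
        (X k : MvPolynomial (Fin n) ℂ) with hy
    have h1 : (fun k => y (Equiv.swap i j k)) = y := by
      funext k
      simp only [hy, aeval_X]
      rcases eq_or_ne k i with rfl | hki
      · simp [Function.update_of_ne hij.ne]
      · rcases eq_or_ne k j with rfl | hkj
        · simp [Function.update_of_ne hij.ne]
        · rw [Equiv.swap_apply_of_ne_of_ne hki hkj]
    have h2 := numSum_perm a h lam y (Equiv.swap i j)
    rw [h1, Equiv.Perm.sign_swap hij.ne] at h2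
    simp only [Units.val_neg, Units.val_one, Int.cast_neg, Int.cast_one, neg_mul, one_mul] at h2
    exact self_eq_neg.1 h2

/-- The polynomial in `x₁, …, xₙ` that represents the symmetric rational function `schurSum`
(see `aeval_schurPoly`): a constant times the exact quotient of the antisymmetric polynomial
`numSum` by the Vandermonde product. -/
def schurPoly (a : ℕ → ℂ) {l : ℕ} (n : ℕ) (lam : Fin l → ℕ) : MvPolynomial (Fin n) ℂ :=
  if h : l ≤ n then
    C (((n - l).factorial : ℕ) : ℂ)⁻¹ * (vdm_dvd_numSum a h lam).choose else 0

theorem aeval_schurPoly {K : Type*} [Field K] [Algebra ℂ K] (a : ℕ → ℂ) {l n : ℕ}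
    (lam : Fin l → ℕ) {y : Fin n → K} (hy : Function.Injective y) :
    aeval y (schurPoly a n lam) = schurSum a n lam y := by
  unfold schurPoly schurSum
  split_ifs with h
  · have h1 := (vdm_dvd_numSum a h lam).choose_spec
    have h2 := congrArg (aeval y) h1
    rw [← numSum_map, map_mul, ← vdm_map] at h2
    simp only [aeval_X] at h2
    rw [numSum_div a h lam hy] at h2
    rw [map_mul, ← mul_left_cancel₀ (vdm_ne_zero hy) h2]
    simp
  · simp

theorem totalDegree_schurPoly_le (a : ℕ → ℂ) {l n : ℕ} (lam : Fin l → ℕ) :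
    (schurPoly a n lam).totalDegree ≤ ∑ i, lam i := by
  unfold schurPoly
  split_ifs with h
  swap
  · simp
  refine (totalDegree_mul _ _).trans ?_
  rw [totalDegree_C, zero_add]
  have h1 := (vdm_dvd_numSum a h lam).choose_spec
  set f := (vdm_dvd_numSum a h lam).choose
  by_cases hf : f = 0
  · simp [hf]
  have hhom : (vdm (X : Fin n → MvPolynomial (Fin n) ℂ)).IsHomogeneous
      (∑ i : Fin n, ∑ j ∈ Finset.Ioi i, 1) := by
    refine IsHomogeneous.prod _ _ _ fun i _ => IsHomogeneous.prod _ _ _ fun j _ => ?_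
    exact (isHomogeneous_X _ _).sub (isHomogeneous_X _ _)
  have hv0 : vdm (X : Fin n → MvPolynomial (Fin n) ℂ) ≠ 0 := by
    intro h0
    rw [vdm, Finset.prod_eq_zero_iff] at h0
    obtain ⟨i, -, h0⟩ := h0
    obtain ⟨j, hj, h0⟩ := Finset.prod_eq_zero_iff.1 h0
    exact (X_sub_X_irreducible (Finset.mem_Ioi.1 hj).ne).ne_zero h0
  have hN : (numSum a h lam (X : Fin n → MvPolynomial (Fin n) ℂ)).totalDegree ≤
      ∑ i, lam i + ∑ i : Fin n, ∑ j ∈ Finset.Ioi i, 1 := by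
    refine totalDegree_finsetSum_le fun ω _ => ?_
    refine (totalDegree_mul _ _).trans ?_
    rw [show (((Equiv.Perm.sign ω : ℤ) : MvPolynomial (Fin n) ℂ)) = C ((Equiv.Perm.sign ω : ℤ) : ℂ)
      by simp, totalDegree_C, zero_add]
    refine (totalDegree_mul _ _).trans (add_le_add ?_ ?_)
    · refine (totalDegree_finsetProd _ _).trans (Finset.sum_le_sum fun i _ => ?_)
      refine (totalDegree_finsetProd _ _).trans ?_
      refine (Finset.sum_le_sum (g := fun _ => 1) fun k _ => ?_).trans (by simp)
      rw [algebraMap_eq]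
      exact (totalDegree_sub_C_le _ _).trans (by simp)
    · refine (totalDegree_finsetProd _ _).trans (Finset.sum_le_sum fun i _ => ?_)
      refine (totalDegree_finsetProd _ _).trans (Finset.sum_le_sum fun j _ => ?_)
      split_ifs
      · exact (totalDegree_add _ _).trans (by simp)
      · exact (totalDegree_sub _ _).trans (by simp)
  rw [h1, totalDegree_mul_of_isDomain hv0 hf, hhom.totalDegree hv0] at hN
  omega

/-! ### Supersymmetry and stability -/

theorem schurSum_perm {K : Type*} [Field K] [Algebra ℂ K] (a : ℕ → ℂ) {l n : ℕ}
    (lam : Fin l → ℕ) (y : Fin n → K) (σ : Equiv.Perm (Fin n)) :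
    schurSum a n lam (fun i => y (σ i)) = schurSum a n lam y := by
  unfold schurSum
  split_ifs with h
  · congr 1
    exact Equiv.sum_comp (Equiv.mulLeft σ) (fun ω => schurTerm a h lam (fun i => y (ω i)))
  · rfl

theorem schurTerm_cancel {K : Type*} [Field K] [Algebra ℂ K] (a : ℕ → ℂ) {l n : ℕ} (h : l ≤ n)
    (lam : Fin l → ℕ) {y y' : Fin n → K} (hy : Function.Injective y)
    (hy' : Function.Injective y') {i j : Fin n} (hij : i < j) (h1 : y j = -y i)
    (h1' : y' j = -y' i) (h2 : ∀ k, k ≠ i → k ≠ j → y k = y' k) :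
    schurTerm a h lam y = schurTerm a h lam y' := by
  by_cases hi : i.val < l
  · have aux : ∀ z : Fin n → K, z j = -z i → schurTerm a h lam z = 0 := by
      intro z hz
      apply mul_eq_zero_of_right
      apply Finset.prod_eq_zero (Finset.mem_univ (⟨i, hi⟩ : Fin l))
      apply Finset.prod_eq_zero (i := j) (by simpa using hij)
      rw [show Fin.castLE h ⟨i, hi⟩ = i from rfl, hz]
      simp
    rw [aux y h1, aux y' h1']
  · have hc : ∀ c : Fin l, Fin.castLE h c < i := fun c => by
      rw [Fin.lt_def]; simp; omega
    have hyc : ∀ c : Fin l, y (Fin.castLE h c) = y' (Fin.castLE h c) := fun c =>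
      h2 _ (hc c).ne ((hc c).trans hij).ne
    have aux : ∀ z : Fin n → K, Function.Injective z → z j = -z i → ∀ c : Fin l,
        ∏ k ∈ Finset.Ioi (Fin.castLE h c),
          (z (Fin.castLE h c) + z k) / (z (Fin.castLE h c) - z k) =
        ∏ k ∈ ((Finset.Ioi (Fin.castLE h c)).erase i).erase j,
          (z (Fin.castLE h c) + z k) / (z (Fin.castLE h c) - z k) := by
      intro z hz hzj c
      have hi' : i ∈ Finset.Ioi (Fin.castLE h c) := Finset.mem_Ioi.2 (hc c)
      have hj' : j ∈ (Finset.Ioi (Fin.castLE h c)).erase i :=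
        Finset.mem_erase.2 ⟨hij.ne', Finset.mem_Ioi.2 ((hc c).trans hij)⟩
      rw [← Finset.mul_prod_erase _ _ hi', ← Finset.mul_prod_erase _ _ hj', ← mul_assoc]
      have e1 : z (Fin.castLE h c) - z i ≠ 0 := sub_ne_zero.2 fun e => (hc c).ne (hz e)
      have e2 : z (Fin.castLE h c) - z j ≠ 0 :=
        sub_ne_zero.2 fun e => ((hc c).trans hij).ne (hz e)
      have : (z (Fin.castLE h c) + z i) / (z (Fin.castLE h c) - z i) *
          ((z (Fin.castLE h c) + z j) / (z (Fin.castLE h c) - z j)) = 1 := by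
        rw [hzj] at e2 ⊢
        rw [div_mul_div_comm, div_eq_one_iff_eq (mul_ne_zero e1 e2)]
        ring
      rw [this, one_mul]
    unfold schurTerm
    congr 1
    · exact Finset.prod_congr rfl fun c _ => by rw [hyc]
    · refine Finset.prod_congr rfl fun c _ => ?_
      rw [aux y hy h1 c, aux y' hy' h1' c]
      refine Finset.prod_congr rfl fun k hk => ?_
      simp only [Finset.mem_erase] at hk
      rw [hyc, h2 k hk.2.1 hk.1]

theorem schurSum_cancel {K : Type*} [Field K] [Algebra ℂ K] (a : ℕ → ℂ) {l n : ℕ}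
    (lam : Fin l → ℕ) {y y' : Fin n → K} (hy : Function.Injective y)
    (hy' : Function.Injective y') {i j : Fin n} (hij : i ≠ j) (h1 : y j = -y i)
    (h1' : y' j = -y' i) (h2 : ∀ k, k ≠ i → k ≠ j → y k = y' k) :
    schurSum a n lam y = schurSum a n lam y' := by
  unfold schurSum
  split_ifs with h
  swap
  · rfl
  congr 1
  refine Finset.sum_congr rfl fun ω _ => ?_
  have hne : ω.symm i ≠ ω.symm j := fun e => hij (ω.symm.injective e)
  rcases hne.lt_or_gt with hlt | hlt
  · refine schurTerm_cancel a h lam (hy.comp ω.injective) (hy'.comp ω.injective) hlt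
      (by simpa using h1) (by simpa using h1') fun k hki hkj => h2 _ ?_ ?_
    · rintro rfl; simp at hki
    · rintro rfl; simp at hkj
  · refine schurTerm_cancel a h lam (hy.comp ω.injective) (hy'.comp ω.injective) hlt
      (by simp [h1]) (by simp [h1']) fun k hki hkj => h2 _ ?_ ?_
    · rintro rfl; simp at hkj
    · rintro rfl; simp at hki

theorem injective_scaled {n : ℕ} {i j : Fin n} {c : ℂ} (hc : c ≠ 0) (hij : i ≠ j) :
    Function.Injective (Function.update (Function.update X i (C c * X i)) j (-(C c * X i)) :
      Fin n → MvPolynomial (Fin n) ℂ) := by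
  set w : Fin n → MvPolynomial (Fin n) ℂ :=
    Function.update (Function.update X i (C c * X i)) j (-(C c * X i)) with hw
  have wi : w i = C c * X i := by simp [hw, Function.update_of_ne hij]
  have wj : w j = -(C c * X i) := by simp [hw]
  have wk : ∀ k, k ≠ i → k ≠ j → w k = X k := fun k h1 h2 => by
    simp [hw, Function.update_of_ne h1, Function.update_of_ne h2]
  have e1 : w i ≠ w j := fun e => by
    rw [wi, wj] at e
    have := congrArg (aeval (fun _ => (1 : ℂ))) e
    simp only [map_mul, map_neg, aeval_X, algHom_C, Algebra.algebraMap_self, RingHom.id_apply,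
      mul_one] at this
    exact hc (self_eq_neg.1 this)
  have e2 : ∀ k, k ≠ i → k ≠ j → w i ≠ w k ∧ w j ≠ w k := fun k h1 h2 => by
    rw [wi, wj, wk k h1 h2]
    constructor <;> intro e <;>
    · have := congrArg (aeval (Pi.single k 1 : Fin n → ℂ)) e
      simp [h1.symm] at this
  intro k k' hkk
  by_contra hne
  rcases eq_or_ne k i with rfl | hki
  · rcases eq_or_ne k' j with rfl | hkj'
    · exact e1 hkk
    · exact (e2 k' (Ne.symm hne) hkj').1 hkk
  · rcases eq_or_ne k j with rfl | hkj
    · rcases eq_or_ne k' i with rfl | hki'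
      · exact e1 hkk.symm
      · exact (e2 k' hki' (Ne.symm hne)).2 hkk
    · rcases eq_or_ne k' i with rfl | hki'
      · exact (e2 k hki hkj).1 hkk.symm
      · rcases eq_or_ne k' j with rfl | hkj'
        · exact (e2 k hki hkj).2 hkk.symm
        · rw [wk k hki hkj, wk k' hki' hkj'] at hkk
          exact hne (X_injective hkk)

theorem schurPoly_isSymmetric (a : ℕ → ℂ) {l n : ℕ} (lam : Fin l → ℕ) :
    (schurPoly a n lam).IsSymmetric := by
  intro σ
  apply IsFractionRing.injective (MvPolynomial (Fin n) ℂ) (FractionRing (MvPolynomial (Fin n) ℂ))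
  set K := FractionRing (MvPolynomial (Fin n) ℂ)
  set y : Fin n → K := fun k => algebraMap (MvPolynomial (Fin n) ℂ) K (X k) with hy
  have hyi : Function.Injective y :=
    (IsFractionRing.injective (MvPolynomial (Fin n) ℂ) K).comp X_injective
  have hφ : ∀ f : MvPolynomial (Fin n) ℂ, algebraMap (MvPolynomial (Fin n) ℂ) K f = aeval y f := by
    intro f
    have : IsScalarTower.toAlgHom ℂ (MvPolynomial (Fin n) ℂ) K = aeval y :=
      algHom_ext fun k => by simp [hy]
    exact DFunLike.congr_fun this f
  rw [hφ, hφ, aeval_rename, aeval_schurPoly a lam (hyi.comp σ.injective), aeval_schurPoly a lam hyi]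
  exact schurSum_perm a lam y σ

theorem schurPoly_isSupersymmetric (a : ℕ → ℂ) {l n : ℕ} (lam : Fin l → ℕ) :
    IsSupersymmetric (schurPoly a n lam) := by
  refine ⟨schurPoly_isSymmetric a lam, fun i j hij => ?_⟩
  set f := schurPoly a n lam with hf
  set K := FractionRing (MvPolynomial (Fin n) ℂ)
  have hinj := IsFractionRing.injective (MvPolynomial (Fin n) ℂ) K
  apply hinj
  set ι : MvPolynomial (Fin n) ℂ →ₐ[ℂ] K := IsScalarTower.toAlgHom ℂ (MvPolynomial (Fin n) ℂ) K
  set w : ℂ → Fin n → MvPolynomial (Fin n) ℂ := fun c =>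
    Function.update (Function.update X i (C c * X i)) j (-(C c * X i)) with hw
  let W : Fin n → Polynomial K :=
    Function.update (Function.update (fun k => Polynomial.C (ι (X k))) i
      (Polynomial.X * Polynomial.C (ι (X i)))) j (-(Polynomial.X * Polynomial.C (ι (X i))))
  let G : Polynomial K := aeval W f
  have hG : ∀ c : ℂ, G.eval (algebraMap ℂ K c) = aeval (fun k => ι (w c k)) f := by
    intro c
    have : ((Polynomial.aeval (algebraMap ℂ K c)).restrictScalars ℂ).comp (aeval W) =
        aeval (fun k => ι (w c k)) := by
      refine algHom_ext fun k => ?_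
      simp only [AlgHom.comp_apply, aeval_X, W, hw, AlgHom.restrictScalars_apply]
      rcases eq_or_ne k j with rfl | hkj
      · simp [← algebraMap_eq]
        ring
      · rcases eq_or_ne k i with rfl | hki
        · simp [Function.update_of_ne hkj, ← algebraMap_eq]
          ring
        · simp [Function.update_of_ne hkj, Function.update_of_ne hki]
    have h2 := DFunLike.congr_fun this f
    rw [← h2]
    simp [G]
  have hconst : ∀ c : ℂ, c ≠ 0 → G.eval (algebraMap ℂ K c) = G.eval (algebraMap ℂ K 1) := by
    intro c hc
    have i1 : Function.Injective fun k => ι (w c k) := hinj.comp (injective_scaled hc hij.ne)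
    have i2 : Function.Injective fun k => ι (w 1 k) :=
      hinj.comp (injective_scaled one_ne_zero hij.ne)
    rw [hG, hG, hf, aeval_schurPoly a lam i1, aeval_schurPoly a lam i2]
    refine schurSum_cancel a lam i1 i2 hij.ne ?_ ?_ fun k hki hkj => ?_
    · simp [hw, Function.update_of_ne hij.ne]
    · simp [hw, Function.update_of_ne hij.ne]
    · simp [hw, Function.update_of_ne hki, Function.update_of_ne hkj]
  have hGC : G = Polynomial.C (G.eval (algebraMap ℂ K 1)) := by
    apply Polynomial.eq_of_infinite_eval_eq
    have hinf : ({c : ℂ | c ≠ 0}).Infinite := (Set.finite_singleton (0 : ℂ)).infinite_compl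
    refine (hinf.image ((algebraMap ℂ K).injective.injOn)).mono ?_
    rintro _ ⟨c, hc, rfl⟩
    rw [Set.mem_ofPred_eq, Polynomial.eval_C]
    exact hconst c hc
  have h01 : G.eval (algebraMap ℂ K 1) = G.eval (algebraMap ℂ K 0) := by
    conv_rhs => rw [hGC]
    simp
  have hι : ∀ c : ℂ, aeval (fun k => ι (w c k)) f = ι (aeval (w c) f) := fun c => by
    have : aeval (fun k => ι (w c k)) = ι.comp (aeval (w c)) := algHom_ext fun k => by simp
    rw [this, AlgHom.comp_apply]
  rw [hG, hG, hι, hι] at h01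
  have w1 : w 1 = Function.update X j (-X i) := by
    simp [hw]
  have w0 : w 0 = Function.update (Function.update X i 0) j 0 := by
    simp [hw]
  rw [w1, w0] at h01
  exact h01

theorem schurTerm_swap {K : Type*} [Field K] [Algebra ℂ K] (a : ℕ → ℂ) {l n : ℕ} (h : l ≤ n)
    (lam : Fin l → ℕ) (y : Fin n → K) {p q : Fin n} (hp : l ≤ p.val) (hq : l ≤ q.val) :
    schurTerm a h lam (fun i => y (Equiv.swap p q i)) = schurTerm a h lam y := by
  have hc : ∀ c : Fin l, Equiv.swap p q (Fin.castLE h c) = Fin.castLE h c := fun c => by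
    apply Equiv.swap_apply_of_ne_of_ne
    · rw [Ne, Fin.ext_iff]; simp; omega
    · rw [Ne, Fin.ext_iff]; simp; omega
  unfold schurTerm
  simp only [hc]
  congr 1
  refine Finset.prod_congr rfl fun c _ => ?_
  refine Finset.prod_equiv (Equiv.swap p q) (fun k => ?_) (fun k _ => rfl)
  simp only [Finset.mem_Ioi, Fin.lt_def, Fin.val_castLE]
  rcases eq_or_ne k p with rfl | hkp
  · simp; omega
  · rcases eq_or_ne k q with rfl | hkq
    · simp; omega
    · rw [Equiv.swap_apply_of_ne_of_ne hkp hkq]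

theorem schurTerm_eq_zero {K : Type*} [Field K] [Algebra ℂ K] {a : ℕ → ℂ} (ha : a 1 = 0)
    {l n : ℕ} (h : l ≤ n) {lam : Fin l → ℕ} (hlam : ∀ i, 0 < lam i) {y : Fin n → K} {p : Fin n}
    (hp : p.val < l) (hy : y p = 0) : schurTerm a h lam y = 0 := by
  apply mul_eq_zero_of_left
  apply Finset.prod_eq_zero (Finset.mem_univ (⟨p, hp⟩ : Fin l))
  rw [show Fin.castLE h ⟨p, hp⟩ = p from rfl, hy, genPow_zero_left ha (hlam _)]

theorem schurTerm_snoc {K : Type*} [Field K] [Algebra ℂ K] (a : ℕ → ℂ) {l n : ℕ} (h : l ≤ n)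
    (lam : Fin l → ℕ) {y : Fin n → K} (hy : ∀ i, y i ≠ 0) :
    schurTerm a (h.trans n.le_succ) lam (Fin.snoc (α := fun _ => K) y 0) =
      schurTerm a h lam y := by
  have hc : ∀ c : Fin l, (Fin.snoc (α := fun _ => K) y 0 : Fin (n + 1) → K)
      (Fin.castLE (h.trans n.le_succ) c) = y (Fin.castLE h c) := fun c => by
    rw [show Fin.castLE (h.trans n.le_succ) c = (Fin.castLE h c).castSucc from rfl,
      Fin.snoc_castSucc]
  unfold schurTerm
  simp only [hc]
  congr 1
  refine Finset.prod_congr rfl fun c _ => ?_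
  have hI : Finset.Ioi (Fin.castLE (h.trans n.le_succ) c) =
      insert (Fin.last n) ((Finset.Ioi (Fin.castLE h c)).map Fin.castSuccEmb) := by
    ext k
    refine Fin.lastCases ?_ (fun k => ?_) k
    · simp [Fin.lt_def]; omega
    · have : k.castSucc ≠ Fin.last n := (Fin.castSucc_lt_last k).ne
      simp [Fin.lt_def, this]
  rw [hI, Finset.prod_insert (by simp), Finset.prod_map]
  simp [hy]

theorem sum_perm_succ {M : Type*} [AddCommMonoid M] {K : Type*} [Zero K] {n : ℕ}
    (Φ : (Fin (n + 1) → K) → M) (y : Fin n → K) :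
    ∑ ω : Equiv.Perm (Fin (n + 1)), Φ (fun i => (Fin.snoc (α := fun _ => K) y 0 : _ → K) (ω i)) =
      ∑ q : Fin (n + 1), ∑ σ : Equiv.Perm (Fin n), Φ (fun i =>
        (Fin.snoc (α := fun _ => K) (fun k => y (σ k)) 0 : _ → K)
          (Equiv.swap (Fin.last n) q i)) := by
  let e : Fin (n + 1) ≃ Option (Fin n) := finSuccEquivLast
  let E : Fin (n + 1) × Equiv.Perm (Fin n) ≃ Equiv.Perm (Fin (n + 1)) :=
    ((e.prodCongr (Equiv.inv _)).trans Equiv.Perm.decomposeOption.symm).trans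
      ((Equiv.inv _).trans e.symm.permCongr)
  rw [← Equiv.sum_comp E, Fintype.sum_prod_type]
  refine Finset.sum_congr rfl fun q _ => Finset.sum_congr rfl fun σ _ => ?_
  congr 1
  funext i
  have hE : E (q, σ) i =
      e.symm (Equiv.optionCongr σ (Equiv.swap none (e q) (e i))) := by
    have h1 : (Equiv.swap none (e q) * Equiv.optionCongr σ⁻¹)⁻¹ =
        Equiv.optionCongr σ * Equiv.swap none (e q) := by
      rw [mul_inv_rev, Equiv.swap_inv]
      rfl
    have h2 : E (q, σ) = e.symm.permCongr (Equiv.swap none (e q) * Equiv.optionCongr σ⁻¹)⁻¹ := rfl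
    rw [h2, h1]
    rfl
  have hsw : Equiv.swap none (e q) (e i) = e (Equiv.swap (Fin.last n) q i) := by
    rw [e.injective.map_swap, finSuccEquivLast_last]
  rw [hE, hsw]
  generalize Equiv.swap (Fin.last n) q i = m
  refine Fin.lastCases ?_ (fun m => ?_) m <;> simp [e]

theorem schurSum_snoc {K : Type*} [Field K] [Algebra ℂ K] {a : ℕ → ℂ} (ha : a 1 = 0)
    {l n : ℕ} {lam : Fin l → ℕ} (hlam : ∀ i, 0 < lam i) {y : Fin n → K} (hy : ∀ i, y i ≠ 0) :
    schurSum a (n + 1) lam (Fin.snoc (α := fun _ => K) y 0) = schurSum a n lam y := by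
  have : CharZero K := charZero_of_injective_algebraMap (algebraMap ℂ K).injective
  unfold schurSum
  split_ifs with h1 h2 h2
  · rw [sum_perm_succ]
    have key : ∀ q : Fin (n + 1), ∑ σ : Equiv.Perm (Fin n), schurTerm a h1 lam (fun i =>
        (Fin.snoc (α := fun _ => K) (fun k => y (σ k)) 0 : _ → K)
          (Equiv.swap (Fin.last n) q i)) =
        if l ≤ q.val then ∑ σ : Equiv.Perm (Fin n), schurTerm a h2 lam (fun i => y (σ i))
        else 0 := by
      intro q
      split_ifs with hq
      · refine Finset.sum_congr rfl fun σ _ => ?_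
        rw [schurTerm_swap a h1 lam _ (by simpa using h2) hq]
        exact schurTerm_snoc a h2 lam fun i => hy _
      · refine Finset.sum_eq_zero fun σ _ => ?_
        exact schurTerm_eq_zero ha h1 hlam (p := q) (by omega) (by simp)
    rw [Finset.sum_congr rfl fun q _ => key q, Finset.sum_ite, Finset.sum_const_zero, add_zero,
      Finset.sum_const, nsmul_eq_mul, ← mul_assoc]
    congr 1
    have hcard : (Finset.univ.filter fun q : Fin (n + 1) => l ≤ q.val).card = n + 1 - l := by
      have : (Finset.univ.filter fun q : Fin (n + 1) => l ≤ q.val) =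
          Finset.Ici ⟨l, by omega⟩ := by
        ext q; simp [Fin.le_def]
      rw [this, Fin.card_Ici]
    rw [hcard, Nat.succ_sub h2, Nat.factorial_succ]
    have e1 : ((n - l + 1 : ℕ) : K) ≠ 0 := Nat.cast_ne_zero.2 (by omega)
    have e2 : ((n - l).factorial : K) ≠ 0 := Nat.cast_ne_zero.2 (Nat.factorial_ne_zero _)
    rw [Nat.cast_mul, Nat.succ_eq_add_one]
    field_simp
  · apply mul_eq_zero_of_right
    refine Finset.sum_eq_zero fun ω _ => ?_
    have hl : l = n + 1 := by omega
    refine schurTerm_eq_zero ha h1 hlam (p := ω.symm (Fin.last n)) (by omega) (by simp)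
  · omega
  · rfl

theorem proj_schurPoly {a : ℕ → ℂ} (ha : a 1 = 0) {l n : ℕ} {lam : Fin l → ℕ}
    (hlam : ∀ i, 0 < lam i) : proj n (schurPoly a (n + 1) lam) = schurPoly a n lam := by
  set K := FractionRing (MvPolynomial (Fin n) ℂ)
  have hinj := IsFractionRing.injective (MvPolynomial (Fin n) ℂ) K
  apply hinj
  set y : Fin n → K := fun k => algebraMap (MvPolynomial (Fin n) ℂ) K (X k) with hy
  have hyi : Function.Injective y := hinj.comp X_injective
  have hy0 : ∀ i, y i ≠ 0 := fun i => by
    rw [hy, Ne, map_eq_zero_iff _ hinj]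
    exact X_ne_zero i
  have hφ : IsScalarTower.toAlgHom ℂ (MvPolynomial (Fin n) ℂ) K = aeval y :=
    algHom_ext fun k => by simp [hy]
  have hψ : (IsScalarTower.toAlgHom ℂ (MvPolynomial (Fin n) ℂ) K).comp (proj n) =
      aeval (Fin.snoc (α := fun _ => K) y 0) := by
    refine algHom_ext fun k => ?_
    refine Fin.lastCases ?_ (fun k => ?_) k <;> simp [proj, hy]
  have e1 := DFunLike.congr_fun hψ (schurPoly a (n + 1) lam)
  have e2 := DFunLike.congr_fun hφ (schurPoly a n lam)
  have hsi : Function.Injective (Fin.snoc (α := fun _ => K) y 0 : Fin (n + 1) → K) := by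
    rw [Fin.snoc_injective_iff]
    exact ⟨hyi, fun ⟨i, hi⟩ => hy0 i hi⟩
  rw [aeval_schurPoly a lam hsi, schurSum_snoc ha hlam hy0] at e1
  rw [aeval_schurPoly a lam hyi] at e2
  exact e1.trans e2.symm

/-! ### The multiparameter Schur `P`-functions -/

/-- The multiparameter Schur `P`-function `P_{lam;a}`, as an element of `Γ`. -/
def multiP (a : ℕ → ℂ) (ha : a 1 = 0) (lam : StrictPartition) : Gamma :=
  ⟨fun n => schurPoly a n lam.parts.get,
    fun _ => schurPoly_isSupersymmetric a _,
    fun _ => proj_schurPoly ha fun i => lam.pos _ (List.get_mem _ i),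
    ∑ i, lam.parts.get i, fun _ => totalDegree_schurPoly_le a _⟩

/-- The `n`-variable component of `P_{lam;a}` is the polynomial given by the symmetrization
`schurSum` of the rational functions `schurTerm`. -/
theorem algebraMap_multiP (a : ℕ → ℂ) (ha : a 1 = 0) (lam : StrictPartition) (n : ℕ) :
    algebraMap (MvPolynomial (Fin n) ℂ) (FractionRing (MvPolynomial (Fin n) ℂ))
        ((multiP a ha lam : ∀ n, MvPolynomial (Fin n) ℂ) n) =
      schurSum a n lam.parts.get (fun i => algebraMap (MvPolynomial (Fin n) ℂ) _ (X i)) := by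
  have hinj := IsFractionRing.injective (MvPolynomial (Fin n) ℂ)
    (FractionRing (MvPolynomial (Fin n) ℂ))
  refine Eq.trans ?_ (aeval_schurPoly a lam.parts.get (hinj.comp X_injective))
  have hφ : IsScalarTower.toAlgHom ℂ (MvPolynomial (Fin n) ℂ)
      (FractionRing (MvPolynomial (Fin n) ℂ)) =
      aeval fun i : Fin n => algebraMap (MvPolynomial (Fin n) ℂ) _ (X i) :=
    algHom_ext fun k => by simp
  exact DFunLike.congr_fun hφ (schurPoly a n lam.parts.get)

/-- The strict partition `(k, l)` with `k > l ≥ 0`; it is the one-row partition `(k)` if `l = 0`. -/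
def twoRow (k l : ℕ) (h : l < k) : StrictPartition where
  parts := if l = 0 then [k] else [k, l]
  sorted := by split_ifs <;> simp [h]
  pos := by
    split_ifs with h0
    · simp; omega
    · simp; omega

/-- `P_{(k,l);a}` for all `k, l ≥ 0`, extended by `P_{(k,l);a} = -P_{(l,k);a}`. -/
def multiP₂ (a : ℕ → ℂ) (ha : a 1 = 0) (k l : ℕ) : Gamma :=
  if h : l < k then multiP a ha (twoRow k l h)
  else if h : k < l then -multiP a ha (twoRow l k h)
  else 0

theorem multiP₂_antisymm (a : ℕ → ℂ) (ha : a 1 = 0) (k l : ℕ) :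
    multiP₂ a ha k l = -multiP₂ a ha l k := by
  unfold multiP₂
  rcases lt_trichotomy k l with h | rfl | h
  · simp [h, h.not_gt]
  · simp
  · simp [h, h.not_gt]

/-! ### Formal series in `u⁻¹` and `v⁻¹` -/

/-- Formal Laurent series in `u⁻¹` and `v⁻¹` over `R`: the coefficient at `(p, q)` is that of
`u^{-p} v^{-q}`, and a subset of `ℤ × ℤ` that can be a support is bounded below. -/
abbrev LSeries₂ (R : Type*) [Zero R] : Type _ := HahnSeries (ℤ × ℤ) R

/-- The variable `u`. -/
def varU (R : Type*) [Semiring R] : LSeries₂ R := HahnSeries.single (-1, 0) 1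

/-- The variable `v`. -/
def varV (R : Type*) [Semiring R] : LSeries₂ R := HahnSeries.single (0, -1) 1

/-- The substitution `f(T) ↦ f(u⁻¹)`. -/
def substU (R : Type*) [CommRing R] : PowerSeries R →+* LSeries₂ R :=
  (HahnSeries.embDomainRingHom ((AddMonoidHom.inl ℤ ℤ).comp (Nat.castAddMonoidHom ℤ))
    (fun x y h => by simpa using h) (fun x y => by simp)).comp
    (HahnSeries.toPowerSeries (R := R)).symm.toRingHom

/-- The substitution `f(T) ↦ f(v⁻¹)`. -/
def substV (R : Type*) [CommRing R] : PowerSeries R →+* LSeries₂ R :=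
  (HahnSeries.embDomainRingHom ((AddMonoidHom.inr ℤ ℤ).comp (Nat.castAddMonoidHom ℤ))
    (fun x y h => by simpa using h) (fun x y => by simp)).comp
    (HahnSeries.toPowerSeries (R := R)).symm.toRingHom

/-- `(1 + x T) / (1 - x T) = (1 + x T) ∑ x^m T^m`, the expansion of `(u + x) / (u - x)` in
`T = u⁻¹`. -/
def cayley {A : Type*} [CommRing A] (x : A) : PowerSeries A :=
  (1 + PowerSeries.C x * PowerSeries.X) * PowerSeries.mk fun m => x ^ m

theorem cayley_mul {A : Type*} [CommRing A] (x : A) :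
    cayley x * (1 - PowerSeries.C x * PowerSeries.X) = 1 + PowerSeries.C x * PowerSeries.X := by
  have : (PowerSeries.mk fun m => x ^ m) * (1 - PowerSeries.C x * PowerSeries.X) = 1 := by
    ext m
    rw [mul_sub, mul_one, map_sub, mul_comm (PowerSeries.C x), ← mul_assoc, PowerSeries.coeff_mul_C]
    cases m with
    | zero => simp
    | succ m => simp [PowerSeries.coeff_succ_mul_X, PowerSeries.coeff_one, pow_succ]
  rw [cayley, mul_assoc, this, mul_one]

theorem map_cayley {A B : Type*} [CommRing A] [CommRing B] (φ : A →+* B) (x : A) :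
    PowerSeries.map φ (cayley x) = cayley (φ x) := by
  have : PowerSeries.map φ (PowerSeries.mk fun m => x ^ m) = PowerSeries.mk fun m => φ x ^ m := by
    ext m; simp
  simp [cayley, this]

theorem cayley_zero {A : Type*} [CommRing A] : cayley (0 : A) = 1 := by
  simpa using cayley_mul (0 : A)

theorem cayley_mul_neg {A : Type*} [CommRing A] [IsDomain A] (x : A) :
    cayley x * cayley (-x) = 1 := by
  have h1 := cayley_mul x
  have h2 := cayley_mul (-x)
  simp only [map_neg, neg_mul, sub_neg_eq_add] at h2
  have h0 : (1 + PowerSeries.C x * PowerSeries.X : PowerSeries A) ≠ 0 := fun h => by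
    have := congrArg (PowerSeries.coeff 0) h
    simp at this
  apply mul_right_cancel₀ h0
  rw [mul_assoc, h2, one_mul, ← sub_eq_add_neg, h1]

/-- `∏_{j=1}^n (1 + x_j T) / (1 - x_j T)`. -/
def cayleyProd (n : ℕ) : PowerSeries (MvPolynomial (Fin n) ℂ) := ∏ j, cayley (X j)

theorem map_cayleyProd {n : ℕ} {B : Type*} [CommRing B] (φ : MvPolynomial (Fin n) ℂ →+* B) :
    PowerSeries.map φ (cayleyProd n) = ∏ j, cayley (φ (X j)) := by
  simp [cayleyProd, map_prod, map_cayley]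

theorem cayleyProd_isSupersymmetric (n r : ℕ) :
    IsSupersymmetric (PowerSeries.coeff r (cayleyProd n)) := by
  constructor
  · intro e
    have := map_cayleyProd (n := n) (rename e : _ →ₐ[ℂ] MvPolynomial (Fin n) ℂ).toRingHom
    have h2 : PowerSeries.map (rename e : _ →ₐ[ℂ] MvPolynomial (Fin n) ℂ).toRingHom (cayleyProd n) =
        cayleyProd n := by
      rw [this, cayleyProd]
      conv_rhs => rw [← Equiv.prod_comp e]
      simp
    have h3 := congrArg (PowerSeries.coeff r) h2
    rwa [PowerSeries.coeff_map] at h3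
  · intro i j hij
    have key : ∀ φ ψ : MvPolynomial (Fin n) ℂ →+* MvPolynomial (Fin n) ℂ,
        φ (X j) = -φ (X i) → ψ (X j) = -ψ (X i) → (∀ k, k ≠ i → k ≠ j → φ (X k) = ψ (X k)) →
        φ (PowerSeries.coeff r (cayleyProd n)) = ψ (PowerSeries.coeff r (cayleyProd n)) := by
      intro φ ψ h1 h2 h3
      have aux : ∀ χ : MvPolynomial (Fin n) ℂ →+* MvPolynomial (Fin n) ℂ, χ (X j) = -χ (X i) →
          ∏ k, cayley (χ (X k)) = ∏ k ∈ (Finset.univ.erase i).erase j, cayley (χ (X k)) := by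
        intro χ hχ
        rw [← Finset.mul_prod_erase _ _ (Finset.mem_univ i),
          ← Finset.mul_prod_erase _ _ (Finset.mem_erase.2 ⟨hij.ne', Finset.mem_univ j⟩),
          ← mul_assoc, hχ, cayley_mul_neg, one_mul]
      have hm : PowerSeries.map φ (cayleyProd n) = PowerSeries.map ψ (cayleyProd n) := by
        rw [map_cayleyProd, map_cayleyProd, aux φ h1, aux ψ h2]
        refine Finset.prod_congr rfl fun k hk => ?_
        simp only [Finset.mem_erase] at hk
        rw [h3 k hk.2.1 hk.1]
      have h4 := congrArg (PowerSeries.coeff r) hm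
      rwa [PowerSeries.coeff_map, PowerSeries.coeff_map] at h4
    refine key
      (aeval (Function.update X j (-X i) : Fin n → MvPolynomial (Fin n) ℂ)).toRingHom
      (aeval (Function.update (Function.update X i 0) j 0 :
        Fin n → MvPolynomial (Fin n) ℂ)).toRingHom ?_ ?_ fun k hki hkj => ?_
    · simp [Function.update_of_ne hij.ne]
    · simp [Function.update_of_ne hij.ne]
    · simp [Function.update_of_ne hki, Function.update_of_ne hkj]

theorem proj_cayleyProd (n r : ℕ) :
    proj n (PowerSeries.coeff r (cayleyProd (n + 1))) = PowerSeries.coeff r (cayleyProd n) := by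
  have h := map_cayleyProd (n := n + 1) (proj n).toRingHom
  rw [Fin.prod_univ_castSucc] at h
  have h2 : PowerSeries.map (proj n).toRingHom (cayleyProd (n + 1)) = cayleyProd n := by
    rw [h]
    simp [proj, cayleyProd, cayley_zero]
  have h3 := congrArg (PowerSeries.coeff r) h2
  rwa [PowerSeries.coeff_map] at h3

theorem totalDegree_cayleyProd_le (n r : ℕ) :
    (PowerSeries.coeff r (cayleyProd n)).totalDegree ≤ r := by
  let S : Submonoid (PowerSeries (MvPolynomial (Fin n) ℂ)) :=
    { carrier := {f | ∀ r, (PowerSeries.coeff r f).totalDegree ≤ r}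
      one_mem' := fun r => by
        rw [PowerSeries.coeff_one]
        split_ifs <;> simp
      mul_mem' := fun {f g} hf hg r => by
        rw [PowerSeries.coeff_mul]
        refine totalDegree_finsetSum_le fun p hp => (totalDegree_mul _ _).trans ?_
        exact (add_le_add (hf _) (hg _)).trans (Finset.HasAntidiagonal.mem_antidiagonal.1 hp).le }
  have : cayleyProd n ∈ S := by
    refine Submonoid.prod_mem _ fun j _ => Submonoid.mul_mem _ ?_ ?_
    · intro r
      rw [map_add]
      refine (totalDegree_add _ _).trans (max_le (S.one_mem r) ?_)
      rw [PowerSeries.coeff_C_mul, PowerSeries.coeff_X]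
      split_ifs with h <;> simp [h]
    · intro r
      rw [PowerSeries.coeff_mk]
      exact (totalDegree_pow _ _).trans (by simp)
  exact this r

/-- The series `∏_{j=1}^∞ (1 + x_j T) / (1 - x_j T)` with coefficients in `Γ`: the coefficient of
`T^r` is the sequence of the coefficients of `T^r` in the products over `j ≤ n`. -/
def infProd : PowerSeries Gamma :=
  PowerSeries.mk fun r => ⟨fun n => PowerSeries.coeff r (cayleyProd n),
    fun n => cayleyProd_isSupersymmetric n r, fun n => proj_cayleyProd n r,
    r, fun n => totalDegree_cayleyProd_le n r⟩

/-- `∏_{j=1}^∞ (u + x_j) / (u - x_j)`. -/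
def prodU : LSeries₂ Gamma := substU Gamma infProd

/-- `∏_{j=1}^∞ (v + x_j) / (v - x_j)`. -/
def prodV : LSeries₂ Gamma := substV Gamma infProd

/-- The `n`-variable component of an element of `Γ`. -/
def component (n : ℕ) : Gamma →+* MvPolynomial (Fin n) ℂ :=
  (Pi.evalRingHom _ n).comp Gamma.val.toRingHom

theorem varU_mul_substU_X (R : Type*) [CommRing R] : varU R * substU R PowerSeries.X = 1 := by
  have : substU R PowerSeries.X = HahnSeries.single (1, 0) 1 := by
    simp only [substU, RingHom.comp_apply]
    rw [show (HahnSeries.toPowerSeries (R := R)).symm.toRingHom PowerSeries.X =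
      HahnSeries.single 1 1 from ?_]
    · refine HahnSeries.embDomain_single.trans ?_
      simp
    · ext m
      simp [PowerSeries.coeff_X, HahnSeries.coeff_single]
  rw [this, varU, HahnSeries.single_mul_single]
  simp [← Prod.zero_eq_mk]

theorem varV_mul_substV_X (R : Type*) [CommRing R] : varV R * substV R PowerSeries.X = 1 := by
  have : substV R PowerSeries.X = HahnSeries.single (0, 1) 1 := by
    simp only [substV, RingHom.comp_apply]
    rw [show (HahnSeries.toPowerSeries (R := R)).symm.toRingHom PowerSeries.X =
      HahnSeries.single 1 1 from ?_]
    · refine HahnSeries.embDomain_single.trans ?_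
      simp
    · ext m
      simp [PowerSeries.coeff_X, HahnSeries.coeff_single]
  rw [this, varV, HahnSeries.single_mul_single]
  simp [← Prod.zero_eq_mk]

theorem substU_C {R : Type*} [CommRing R] (x : R) :
    substU R (PowerSeries.C x) = HahnSeries.C x := by
  simp only [substU, RingHom.comp_apply]
  rw [show (HahnSeries.toPowerSeries (R := R)).symm.toRingHom (PowerSeries.C x) =
    HahnSeries.C x from ?_]
  · exact HahnSeries.embDomainRingHom_C
  · ext m
    simp [PowerSeries.coeff_C, HahnSeries.coeff_single]

theorem substV_C {R : Type*} [CommRing R] (x : R) :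
    substV R (PowerSeries.C x) = HahnSeries.C x := by
  simp only [substV, RingHom.comp_apply]
  rw [show (HahnSeries.toPowerSeries (R := R)).symm.toRingHom (PowerSeries.C x) =
    HahnSeries.C x from ?_]
  · exact HahnSeries.embDomainRingHom_C
  · ext m
    simp [PowerSeries.coeff_C, HahnSeries.coeff_single]

theorem varU_sub_C {R : Type*} [CommRing R] (x : R) :
    varU R - HahnSeries.C x = varU R * substU R (1 - PowerSeries.C x * PowerSeries.X) := by
  rw [map_sub, map_mul, map_one, substU_C]
  linear_combination HahnSeries.C x * varU_mul_substU_X R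

theorem varV_sub_C {R : Type*} [CommRing R] (x : R) :
    varV R - HahnSeries.C x = varV R * substV R (1 - PowerSeries.C x * PowerSeries.X) := by
  rw [map_sub, map_mul, map_one, substV_C]
  linear_combination HahnSeries.C x * varV_mul_substV_X R

theorem isUnit_one_sub_C_mul_X {R : Type*} [CommRing R] (x : R) :
    IsUnit (1 - PowerSeries.C x * PowerSeries.X : PowerSeries R) := by
  rw [PowerSeries.isUnit_iff_constantCoeff]
  simp

/-- The inverses that occur in the generating function are genuine inverses. -/
theorem isUnit_genPow_varU (a : ℕ → ℂ) (k : ℕ) : IsUnit (genPow a (varU Gamma) k) := by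
  rw [genPow, IsUnit.prod_iff]
  intro i _
  rw [show algebraMap ℂ (LSeries₂ Gamma) (a i) = HahnSeries.C (algebraMap ℂ Gamma (a i)) from rfl,
    varU_sub_C]
  exact (IsUnit.of_mul_eq_one _ (varU_mul_substU_X _)).mul
    ((isUnit_one_sub_C_mul_X _).map (substU _))

/-- The inverses that occur in the generating function are genuine inverses. -/
theorem isUnit_genPow_varV (a : ℕ → ℂ) (k : ℕ) : IsUnit (genPow a (varV Gamma) k) := by
  rw [genPow, IsUnit.prod_iff]
  intro i _
  rw [show algebraMap ℂ (LSeries₂ Gamma) (a i) = HahnSeries.C (algebraMap ℂ Gamma (a i)) from rfl,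
    varV_sub_C]
  exact (IsUnit.of_mul_eq_one _ (varV_mul_substV_X _)).mul
    ((isUnit_one_sub_C_mul_X _).map (substV _))

theorem map_component_infProd (n : ℕ) : PowerSeries.map (component n) infProd = cayleyProd n := by
  ext1 r
  rw [PowerSeries.coeff_map, infProd, PowerSeries.coeff_mk]
  rfl

theorem map_substU {R S : Type*} [CommRing R] [CommRing S] (φ : R →+* S) (f : PowerSeries R) :
    (substU R f).map φ = substU S (PowerSeries.map φ f) := by
  ext g
  by_cases hg : ∃ m : ℕ, ((AddMonoidHom.inl ℤ ℤ).comp (Nat.castAddMonoidHom ℤ)) m = g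
  · obtain ⟨m, rfl⟩ := hg
    refine (congrArg φ (HahnSeries.embDomain_mk_coeff _ _)).trans
      (Eq.trans ?_ (HahnSeries.embDomain_mk_coeff _ _).symm)
    simp
  · refine (congrArg φ (HahnSeries.embDomain_of_notMem_range ?_)).trans
      (Eq.trans (map_zero φ) (HahnSeries.embDomain_of_notMem_range ?_).symm) <;>
    · rintro ⟨m, hm⟩
      exact hg ⟨m, hm⟩

theorem map_substV {R S : Type*} [CommRing R] [CommRing S] (φ : R →+* S) (f : PowerSeries R) :
    (substV R f).map φ = substV S (PowerSeries.map φ f) := by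
  ext g
  by_cases hg : ∃ m : ℕ, ((AddMonoidHom.inr ℤ ℤ).comp (Nat.castAddMonoidHom ℤ)) m = g
  · obtain ⟨m, rfl⟩ := hg
    refine (congrArg φ (HahnSeries.embDomain_mk_coeff _ _)).trans
      (Eq.trans ?_ (HahnSeries.embDomain_mk_coeff _ _).symm)
    simp
  · refine (congrArg φ (HahnSeries.embDomain_of_notMem_range ?_)).trans
      (Eq.trans (map_zero φ) (HahnSeries.embDomain_of_notMem_range ?_).symm) <;>
    · rintro ⟨m, hm⟩
      exact hg ⟨m, hm⟩

/-- In `n` variables, `prodU` is `∏_{j=1}^n (u + x_j) / (u - x_j)`. -/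
theorem map_prodU (n : ℕ) :
    (prodU.map (component n) : LSeries₂ (MvPolynomial (Fin n) ℂ)) *
        ∏ j : Fin n, (varU _ - HahnSeries.C (X j)) =
      ∏ j : Fin n, (varU _ + HahnSeries.C (X j)) := by
  rw [prodU, map_substU, map_component_infProd, cayleyProd, map_prod, ← Finset.prod_mul_distrib]
  refine Finset.prod_congr rfl fun j _ => ?_
  have h := varU_sub_C (-X j : MvPolynomial (Fin n) ℂ)
  simp only [map_neg, sub_neg_eq_add, neg_mul] at h
  rw [varU_sub_C, mul_left_comm, ← map_mul, cayley_mul, h]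

/-- In `n` variables, `prodV` is `∏_{j=1}^n (v + x_j) / (v - x_j)`. -/
theorem map_prodV (n : ℕ) :
    (prodV.map (component n) : LSeries₂ (MvPolynomial (Fin n) ℂ)) *
        ∏ j : Fin n, (varV _ - HahnSeries.C (X j)) =
      ∏ j : Fin n, (varV _ + HahnSeries.C (X j)) := by
  rw [prodV, map_substV, map_component_infProd, cayleyProd, map_prod, ← Finset.prod_mul_distrib]
  refine Finset.prod_congr rfl fun j _ => ?_
  have h := varV_sub_C (-X j : MvPolynomial (Fin n) ℂ)
  simp only [map_neg, sub_neg_eq_add, neg_mul] at h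
  rw [varV_sub_C, mul_left_comm, ← map_mul, cayley_mul, h]

end

end MultiSchur

open MultiSchur

namespace MultiSchur

noncomputable section

/-! An identity in Γ holds as soon as it holds for every number `n` of variables, and there it can
be checked over the field of rational functions, at the generic point `y`. Let `w_i = ∏_{j≠i} (y_i +
y_j)/(y_i - y_j)` (`cayleyWeight`). The symmetrizations collapse to sums over indices
(`schurSum_one`, `schurSum_two`): `P_(k) = ∑ w_i (y_i|a)^k` for `k > 0` and `P_(k,l) = ∑ w_i w_j
r_ij (y_i|a)^k (y_j|a)^l` for `k > l > 0`, with `r_ij = (y_j - y_i)/(y_i + y_j)`.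

Since `∑_k (y|a)^k/(u|a)^{k+1} = 1/(u - y)`, whose term `k = 0` is `1/u` because `a_1 = 0`, the
generating function becomes a finite expression in `U_i = 1/(u - y_i)`, `V_j = 1/(v - y_j)`, `1/u`
and `1/v` (`map_hsum_twoRowFamily`); the parameters `a` have disappeared. As `u(U_i - 1/u) = y_i
U_i`, multiplication by `4uv` turns each `w_i` into the residue `α_i = 2 y_i w_i` of `F(u) = ∏ (u +
y_j)/(u - y_j)` at `y_i`.

Put `A = ∑ α_i U_i` and `B = ∑ α_j V_j`, so that `F(u) = 1 + A` and `F(v) = 1 + B` by partial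
fractions. The relation `F(-y_i) = 0` says `∑_j α_j/(y_i + y_j) = 1`, and this evaluates `(u + v) ∑
α_i α_j r_ij U_i V_j` as a quadratic polynomial in `A` and `B` (`add_mul_sum_cayleyWeight`). Adding
the one-row contribution `(u + v)(2A - 2B)` gives `(v - u)AB + 2vA - 2uB`, which is the right-hand
side (`two_row_identity`). -/

/-! ### Partial fractions -/

/-- The weight `∏_{j ≠ i} (y_i + y_j) / (y_i - y_j)`. -/
def cayleyWeight {K : Type*} [Field K] {n : ℕ} (y : Fin n → K) (i : Fin n) : K :=
  ∏ j ∈ Finset.univ.erase i, (y i + y j) / (y i - y j)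

/-- The partial fraction expansion of `∏ (t + y_j) / (t - y_j)`, with cleared denominators. -/
theorem prod_X_add_C_eq {K : Type*} [Field K] {n : ℕ} {y : Fin n → K}
    (hy : Function.Injective y) :
    ∏ j, (Polynomial.X + Polynomial.C (y j)) = ∏ j, (Polynomial.X - Polynomial.C (y j)) +
      ∑ i, Polynomial.C (2 * y i * cayleyWeight y i) *
        ∏ j ∈ Finset.univ.erase i, (Polynomial.X - Polynomial.C (y j)) := by
  -- Lagrange interpolation: the two sides differ by a polynomial of degree less than `n` and agree
  -- at the `n` distinct points `y_i`.
  refine Polynomial.eq_of_degree_sub_lt_of_eval_index_eq Finset.univ (v := y) hy.injOn ?_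
    fun i _ => ?_
  · rw [← sub_sub]
    refine (Polynomial.degree_sub_le _ _).trans_lt (max_lt ?_ ?_)
    · have hm : (∏ j, (Polynomial.X + Polynomial.C (y j))).Monic :=
        Polynomial.monic_prod_of_monic _ _ fun j _ => Polynomial.monic_X_add_C _
      have hm' : (∏ j, (Polynomial.X - Polynomial.C (y j))).Monic :=
        Polynomial.monic_prod_of_monic _ _ fun j _ => Polynomial.monic_X_sub_C _
      have hd : (∏ j, (Polynomial.X + Polynomial.C (y j))).degree =
          ((Finset.univ : Finset (Fin n)).card : WithBot ℕ) := by
        simp [Polynomial.degree_prod, Polynomial.degree_X_add_C]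
      have hd' : (∏ j, (Polynomial.X - Polynomial.C (y j))).degree =
          ((Finset.univ : Finset (Fin n)).card : WithBot ℕ) := by
        simp [Polynomial.degree_prod, Polynomial.degree_X_sub_C]
      -- Both products are monic of degree `n`, so the leading terms cancel in their difference.
      rw [← hd]
      refine Polynomial.degree_sub_lt_left (hd.trans hd'.symm) hm.ne_zero ?_
      rw [hm.leadingCoeff, hm'.leadingCoeff]
    · refine (Polynomial.degree_sum_le _ _).trans_lt ?_
      rw [Finset.sup_lt_iff (WithBot.bot_lt_coe _)]
      intro i hi
      refine (Polynomial.smul_eq_C_mul (R := K) _ ▸ Polynomial.degree_smul_le _ _).trans_lt ?_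
      rw [Polynomial.degree_prod, Finset.sum_congr rfl fun j _ => Polynomial.degree_X_sub_C _,
        Finset.sum_const, nsmul_one]
      exact_mod_cast Finset.card_erase_lt_of_mem hi
  -- At `y_i` only the `i`-th summand survives. Its weight cancels the factors `y_i - y_j`, and `2
  -- y_i` is the factor `j = i` of the left side.
  · have h0 : ∏ j, (y i - y j) = 0 := Finset.prod_eq_zero (Finset.mem_univ i) (sub_self _)
    have hs : ∀ k ∈ Finset.univ, k ≠ i →
        2 * y k * cayleyWeight y k * ∏ j ∈ Finset.univ.erase k, (y i - y j) = 0 :=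
      fun k _ hk => mul_eq_zero_of_right _ (Finset.prod_eq_zero
        (Finset.mem_erase.2 ⟨hk.symm, Finset.mem_univ i⟩) (sub_self _))
    simp only [Polynomial.eval_prod, Polynomial.eval_add, Polynomial.eval_sub, Polynomial.eval_X,
      Polynomial.eval_C, Polynomial.eval_finsetSum, Polynomial.eval_mul, h0, zero_add]
    rw [Finset.sum_eq_single i hs (by simp), cayleyWeight, mul_assoc, ← Finset.prod_mul_distrib,
      ← Finset.mul_prod_erase _ _ (Finset.mem_univ i), ← two_mul]
    congr 1
    refine Finset.prod_congr rfl fun j hj => ?_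
    rw [div_mul_cancel₀ _ (sub_ne_zero.2 fun e => (Finset.ne_of_mem_erase hj) (hy e).symm)]

/-- This is the partial fraction expansion at `t = -y_i`, where `∏ (t + y_j)` vanishes. It is the
only relation between the weights that the quadratic identity needs. -/
theorem sum_cayleyWeight_div {K : Type*} [Field K] {n : ℕ} {y : Fin n → K}
    (hy : Function.Injective y) (hs : ∀ i j, y i + y j ≠ 0) (i : Fin n) :
    ∑ j, 2 * y j * cayleyWeight y j / (y i + y j) = 1 := by
  have h := congrArg (Polynomial.eval (-y i)) (prod_X_add_C_eq hy)
  simp only [Polynomial.eval_prod, Polynomial.eval_add, Polynomial.eval_sub, Polynomial.eval_X,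
      Polynomial.eval_C, Polynomial.eval_finsetSum, Polynomial.eval_mul] at h
  have hn : ∀ j, -y i - y j ≠ 0 := fun j e => hs i j (by linear_combination -e)
  have h0 : ∏ j, (-y i - y j) ≠ 0 := Finset.prod_ne_zero_iff.2 fun j _ => hn j
  rw [Finset.prod_eq_zero (Finset.mem_univ i) (neg_add_cancel _)] at h
  apply mul_right_cancel₀ h0
  rw [Finset.sum_mul, one_mul, ← sub_eq_zero, ← neg_eq_zero, h, neg_sub, sub_eq_add_neg,
    ← Finset.sum_neg_distrib]
  congr 1
  refine Finset.sum_congr rfl fun j _ => ?_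
  rw [← Finset.mul_prod_erase _ _ (Finset.mem_univ j)]
  have := hs i j
  field_simp
  ring

/-- Here `L` is only a commutative ring, in the application the ring of Laurent series. Fractions
are therefore given by their defining equations, and the cleared expansion is divided by multiplying
with `∏ U_j`. -/
theorem eq_one_add_sum_cayleyWeight {K L : Type*} [Field K] [CommRing L] [Algebra K L] {n : ℕ}
    {y : Fin n → K} (hy : Function.Injective y) {t F : L} {U : Fin n → L}
    (hU : ∀ i, (t - algebraMap K L (y i)) * U i = 1)
    (hF : F * ∏ j, (t - algebraMap K L (y j)) = ∏ j, (t + algebraMap K L (y j))) :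
    F = 1 + ∑ i, algebraMap K L (2 * y i * cayleyWeight y i) * U i := by
  have h := congrArg (Polynomial.aeval t) (prod_X_add_C_eq hy)
  simp only [map_prod, map_add, map_sub, Polynomial.aeval_X, Polynomial.aeval_C, map_sum, map_mul]
    at h
  rw [← hF] at h
  have hP : (∏ j, (t - algebraMap K L (y j))) * ∏ j, U j = 1 := by
    rw [← Finset.prod_mul_distrib, Finset.prod_eq_one fun j _ => hU j]
  have hi : ∀ i, (∏ j ∈ Finset.univ.erase i, (t - algebraMap K L (y j))) * ∏ j, U j = U i := by
    intro i
    rw [← Finset.mul_prod_erase _ U (Finset.mem_univ i), mul_left_comm, ← Finset.prod_mul_distrib,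
      Finset.prod_eq_one fun j _ => hU j, mul_one]
  have h2 := congrArg (· * ∏ j, U j) h
  simp only [add_mul, Finset.sum_mul, mul_assoc, hP, hi, mul_one] at h2
  simpa only [map_mul, mul_assoc] using h2

/-- The quadratic identity for the simple fractions `U i = 1 / (u - y_i)`, `V i = 1 / (v - y_i)`. -/
theorem add_mul_sum_cayleyWeight {K L : Type*} [Field K] [CommRing L] [Algebra K L] {n : ℕ}
    {y : Fin n → K} (hy : Function.Injective y) (hs : ∀ i j, y i + y j ≠ 0) {u v : L}
    {U V : Fin n → L} (hU : ∀ i, (u - algebraMap K L (y i)) * U i = 1)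
    (hV : ∀ i, (v - algebraMap K L (y i)) * V i = 1) {α : Fin n → K}
    (hα : ∀ i, α i = 2 * y i * cayleyWeight y i) :
    (u + v) * ∑ i, ∑ j, algebraMap K L (α i * α j * ((y j - y i) / (y i + y j))) * (U i * V j) =
      (v - u) * (∑ i, algebraMap K L (α i) * U i) * (∑ j, algebraMap K L (α j) * V j) -
        2 * u * (∑ i, algebraMap K L (α i) * U i) + 2 * v * ∑ j, algebraMap K L (α j) * V j := by
  set c := algebraMap K L
  have key : ∀ i, ∑ j, α j / (y i + y j) = 1 := fun i => by
    simp only [hα]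
    exact sum_cayleyWeight_div hy hs i
  -- Let `r = (y_j - y_i)/(y_i + y_j)`. From `u U_i = 1 + y_i U_i` and `v V_j = 1 + y_j V_j`, both
  -- `(u + v) r U_i V_j - r(U_i + V_j)` and `(v - u) U_i V_j - (U_i - V_j)` equal `(y_j - y_i) U_i
  -- V_j`. What remains is `(r - 1) U_i + (r + 1) V_j`, with `r - 1 = -2y_i/(y_i + y_j)` and `r + 1
  -- = 2y_j/(y_i + y_j)`; one index can then be summed away by `key`.
  have hterm : ∀ i j, (u + v) * (c (α i * α j * ((y j - y i) / (y i + y j))) * (U i * V j)) =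
      (v - u) * ((c (α i) * U i) * (c (α j) * V j)) -
        2 * (c (α i) * c (y i) * U i) * c (α j / (y i + y j)) +
        2 * (c (α j) * c (y j) * V j) * c (α i / (y j + y i)) := by
    intro i j
    have e1 : c ((y j - y i) / (y i + y j)) = 1 - 2 * c (y i) * c (1 / (y i + y j)) := by
      rw [← map_one c, ← map_ofNat c 2, ← map_mul, ← map_mul, ← map_sub]
      congr 1
      have := hs i j
      field_simp
      ring
    have e2 : (c (y i) + c (y j)) * c (1 / (y i + y j)) = 1 := by
      rw [← map_add, ← map_mul, mul_one_div_cancel (hs i j), map_one]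
    rw [add_comm (y j) (y i), div_eq_mul_one_div (α j), div_eq_mul_one_div (α i), map_mul,
      map_mul, map_mul, map_mul, e1]
    set w := c (1 / (y i + y j))
    linear_combination (c (α i) * c (α j)) *
      ((1 - 2 * c (y i) * w) * (V j * hU i + U i * hV j) + V j * hU i - U i * hV j -
        2 * V j * e2 - 2 * U i * V j * c (y i) * e2)
  have hU' : ∀ i, ∑ j, 2 * (c (α i) * c (y i) * U i) * c (α j / (y i + y j)) =
      2 * (c (α i) * c (y i) * U i) := fun i => by
    rw [← Finset.mul_sum, ← map_sum, key, map_one, mul_one]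
  have hV' : ∀ j, ∑ i, 2 * (c (α j) * c (y j) * V j) * c (α i / (y j + y i)) =
      2 * (c (α j) * c (y j) * V j) := fun j => by
    rw [← Finset.mul_sum, ← map_sum, key, map_one, mul_one]
  rw [mul_assoc (v - u), Finset.sum_mul_sum]
  simp only [Finset.mul_sum, hterm, Finset.sum_add_distrib, Finset.sum_sub_distrib, hU']
  have hc : ∑ i, ∑ j, 2 * (c (α j) * c (y j) * V j) * c (α i / (y j + y i)) =
      ∑ j, 2 * (c (α j) * c (y j) * V j) := by
    rw [Finset.sum_comm, Finset.sum_congr rfl fun j _ => hV' j]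
  -- Use `y_i U_i = u U_i - 1` and `y_i V_i = v V_i - 1`; the constants `2 ∑ α_i` cancel between the
  -- two sums.
  have hd : (∑ i, 2 * (c (α i) * c (y i) * U i)) - ∑ j, 2 * (c (α j) * c (y j) * V j) =
      (∑ i, 2 * u * (c (α i) * U i)) - ∑ j, 2 * v * (c (α j) * V j) := by
    rw [← Finset.sum_sub_distrib, ← Finset.sum_sub_distrib]
    refine Finset.sum_congr rfl fun i _ => ?_
    linear_combination (2 * c (α i)) * (hV i - hU i)
  rw [hc]
  linear_combination -hd

/-! ### One-row and two-row symmetrizations -/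

theorem sum_perm_apply_zero {M : Type*} [AddCommMonoid M] {n : ℕ} (f : Fin (n + 1) → M) :
    ∑ ω : Equiv.Perm (Fin (n + 1)), f (ω 0) = n.factorial • ∑ i, f i := by
  rw [← Equiv.sum_comp Equiv.Perm.decomposeFin.symm, Fintype.sum_prod_type, Finset.smul_sum]
  refine Finset.sum_congr rfl fun i _ => ?_
  simp [Equiv.Perm.decomposeFin_symm_apply_zero, Fintype.card_perm]

theorem sum_perm_apply_zero_one {M : Type*} [AddCommMonoid M] {n : ℕ}
    (f : Fin (n + 2) → Fin (n + 2) → M) :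
    ∑ ω : Equiv.Perm (Fin (n + 2)), f (ω 0) (ω 1) =
      n.factorial • ∑ i, ∑ j ∈ Finset.univ.erase i, f i j := by
  rw [← Equiv.sum_comp Equiv.Perm.decomposeFin.symm, Fintype.sum_prod_type, Finset.smul_sum]
  refine Finset.sum_congr rfl fun i _ => ?_
  simp only [Equiv.Perm.decomposeFin_symm_apply_zero, Equiv.Perm.decomposeFin_symm_apply_one]
  rw [sum_perm_apply_zero fun k => f i (Equiv.swap 0 i k.succ)]
  congr 1
  -- Once `ω 0 = i` is fixed, the values `swap 0 i k.succ` of `ω 1` run exactly once through the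
  -- indices other than `i`.
  refine Finset.sum_bij (fun k _ => Equiv.swap 0 i k.succ) (fun k _ => ?_)
    (fun k _ k' _ h => by simpa using h) (fun j hj => ?_) fun _ _ => rfl
  · refine Finset.mem_erase.2 ⟨fun h => ?_, Finset.mem_univ _⟩
    rw [Equiv.swap_apply_eq_iff, Equiv.swap_apply_right] at h
    exact Fin.succ_ne_zero _ h
  · have : Equiv.swap 0 i j ≠ 0 := fun h => by
      rw [Equiv.swap_apply_eq_iff, Equiv.swap_apply_left] at h
      exact Finset.ne_of_mem_erase hj h
    obtain ⟨k, hk⟩ := Fin.exists_succ_eq.2 this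
    exact ⟨k, Finset.mem_univ _, by rw [hk, Equiv.swap_apply_self]⟩

/-- The summand depends on `ω` only through `ω 0`, since `ω j` for `j > 0` runs through all other
indices. The `(n - 1)!` permutations with the same `ω 0` cancel the normalization. -/
theorem schurSum_one {K : Type*} [Field K] [Algebra ℂ K] (a : ℕ → ℂ) (n : ℕ) (lam : Fin 1 → ℕ)
    (y : Fin n → K) :
    schurSum a n lam y = ∑ i, genPow a (y i) (lam 0) * cayleyWeight y i := by
  have : CharZero K := charZero_of_injective_algebraMap (algebraMap ℂ K).injective
  cases n with
  | zero => simp [schurSum]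
  | succ n =>
    have key : ∀ ω : Equiv.Perm (Fin (n + 1)),
        schurTerm a (Nat.le_add_left 1 n) lam (fun i => y (ω i)) =
          genPow a (y (ω 0)) (lam 0) * cayleyWeight y (ω 0) := by
      intro ω
      have hI : Finset.Ioi (0 : Fin (n + 1)) = Finset.univ.erase 0 := by
        ext j; simp
      simp only [schurTerm, Fin.prod_univ_one, cayleyWeight]
      rw [show Fin.castLE (Nat.le_add_left 1 n) 0 = 0 from rfl, hI]
      congr 1
      refine Finset.prod_equiv ω (fun j => ?_) fun _ _ => rfl
      simp
    rw [schurSum, dif_pos (Nat.le_add_left 1 n), Finset.sum_congr rfl fun ω _ => key ω,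
      sum_perm_apply_zero fun i => genPow a (y i) (lam 0) * cayleyWeight y i, nsmul_eq_mul,
      Nat.add_sub_cancel, inv_mul_cancel_left₀ (Nat.cast_ne_zero.2 n.factorial_ne_zero)]

/-- The summand depends only on `i = ω 0` and `j = ω 1`. The product `w_i w_j` has one factor too
many, `(y_j + y_i)/(y_j - y_i)` inside `w_j`, and `(y_j - y_i)/(y_i + y_j)` removes it. That factor
vanishes for `i = j`, so the diagonal may be included; for `n ≤ 1` both sides are zero. -/
theorem schurSum_two {K : Type*} [Field K] [Algebra ℂ K] (a : ℕ → ℂ) (n : ℕ) (lam : Fin 2 → ℕ)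
    {y : Fin n → K} (hy : Function.Injective y) (hs : ∀ i j, y i + y j ≠ 0) :
    schurSum a n lam y = ∑ i, ∑ j, cayleyWeight y i * cayleyWeight y j *
      ((y j - y i) / (y i + y j)) * (genPow a (y i) (lam 0) * genPow a (y j) (lam 1)) := by
  have : CharZero K := charZero_of_injective_algebraMap (algebraMap ℂ K).injective
  match n, y, hy, hs with
  | 0, y, hy, hs => simp [schurSum]
  | 1, y, hy, hs => simp [schurSum]
  | n + 2, y, hy, hs =>
    set f : Fin (n + 2) → Fin (n + 2) → K := fun i j => cayleyWeight y i * cayleyWeight y j *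
      ((y j - y i) / (y i + y j)) * (genPow a (y i) (lam 0) * genPow a (y j) (lam 1)) with hf
    have key : ∀ ω : Equiv.Perm (Fin (n + 2)),
        schurTerm a (Nat.le_add_left 2 n) lam (fun i => y (ω i)) = f (ω 0) (ω 1) := by
      intro ω
      have hI : Finset.Ioi (0 : Fin (n + 2)) = Finset.univ.erase 0 := by
        ext j; simp
      have hI' : Finset.Ioi (1 : Fin (n + 2)) = (Finset.univ.erase 0).erase 1 := by
        ext j
        have h0 : (0 : Fin (n + 2)).val = 0 := rfl
        simp only [Finset.mem_Ioi, Finset.mem_erase, Fin.lt_def, Ne, Fin.ext_iff, Fin.val_one, h0,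
          Finset.mem_univ, and_true]
        omega
      have hJ : (1 : Fin (n + 2)) ∈ (Finset.univ.erase 0 : Finset (Fin (n + 2))) := by simp
      have h10 : ω 1 ≠ ω 0 := fun h => by simpa using ω.injective h
      have e1 : ∏ j ∈ (Finset.univ.erase 0 : Finset (Fin (n + 2))),
          (y (ω 0) + y (ω j)) / (y (ω 0) - y (ω j)) = cayleyWeight y (ω 0) :=
        Finset.prod_equiv ω (fun j => by simp) fun _ _ => rfl
      have e2 : cayleyWeight y (ω 1) = (y (ω 1) + y (ω 0)) / (y (ω 1) - y (ω 0)) *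
          ∏ j ∈ (Finset.univ.erase 0).erase 1, (y (ω 1) + y (ω j)) / (y (ω 1) - y (ω j)) := by
        rw [cayleyWeight, ← Finset.mul_prod_erase _ _
          (Finset.mem_erase.2 ⟨h10.symm, Finset.mem_univ (ω 0)⟩)]
        congr 1
        refine (Finset.prod_equiv ω (fun j => ?_) fun _ _ => rfl).symm
        simp [and_comm]
      simp only [schurTerm, Fin.prod_univ_two, hf]
      rw [show Fin.castLE (Nat.le_add_left 2 n) 0 = 0 from rfl,
        show Fin.castLE (Nat.le_add_left 2 n) 1 = 1 from rfl, hI, hI', e1, e2]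
      have h1 := hs (ω 0) (ω 1)
      have h2 := hs (ω 1) (ω 0)
      have h3 : y (ω 1) - y (ω 0) ≠ 0 := sub_ne_zero.2 fun e => h10 (hy e)
      field_simp
      ring
    rw [schurSum, dif_pos (Nat.le_add_left 2 n), Finset.sum_congr rfl fun ω _ => key ω,
      sum_perm_apply_zero_one f, nsmul_eq_mul,
      Nat.add_sub_cancel, inv_mul_cancel_left₀ (Nat.cast_ne_zero.2 n.factorial_ne_zero)]
    refine Finset.sum_congr rfl fun i _ => Finset.sum_erase _ ?_
    simp [hf]

/-- `(x | a)^k` for `k > 0`, and `0` for `k = 0`. -/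
def genPowPos {A : Type*} [CommRing A] [Algebra ℂ A] (a : ℕ → ℂ) (x : A) (k : ℕ) : A :=
  if k = 0 then 0 else genPow a x k

/-- The generic point `(x₁, …, xₙ)` in the field of rational functions. -/
def genericPoint (n : ℕ) (i : Fin n) : FractionRing (MvPolynomial (Fin n) ℂ) :=
  algebraMap (MvPolynomial (Fin n) ℂ) _ (MvPolynomial.X i)

/-- The `n`-variable component of an element of `Γ`, as a rational function. -/
def ratComponent (n : ℕ) : Gamma →+* FractionRing (MvPolynomial (Fin n) ℂ) :=
  (algebraMap _ _).comp (component n)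

theorem genericPoint_injective (n : ℕ) : Function.Injective (genericPoint n) :=
  (IsFractionRing.injective (MvPolynomial (Fin n) ℂ) _).comp MvPolynomial.X_injective

theorem genericPoint_add_ne_zero {n : ℕ} (i j : Fin n) : genericPoint n i + genericPoint n j ≠ 0 := by
  rw [genericPoint, genericPoint, ← map_add, Ne,
    map_eq_zero_iff _ (IsFractionRing.injective (MvPolynomial (Fin n) ℂ) _)]
  intro h
  have := congrArg (MvPolynomial.aeval (fun _ => (1 : ℂ))) h
  norm_num at this

theorem ratComponent_multiP_one (a : ℕ → ℂ) (ha : a 1 = 0) (n k : ℕ) (h : 0 < k) :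
    ratComponent n (multiP a ha (twoRow k 0 h)) =
      ∑ i, genPow a (genericPoint n i) k * cayleyWeight (genericPoint n) i :=
  (algebraMap_multiP a ha (twoRow k 0 h) n).trans (schurSum_one a n (fun _ => k) (genericPoint n))

theorem ratComponent_multiP_two (a : ℕ → ℂ) (ha : a 1 = 0) (n : ℕ) {k l : ℕ} (hl : l ≠ 0)
    (h : l < k) :
    ratComponent n (multiP a ha (twoRow k l h)) =
      ∑ i, ∑ j, cayleyWeight (genericPoint n) i * cayleyWeight (genericPoint n) j *
      ((genericPoint n j - genericPoint n i) / (genericPoint n i + genericPoint n j)) *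
        (genPow a (genericPoint n i) k * genPow a (genericPoint n j) l) := by
  have hp : (twoRow k l h).parts = [k, l] := if_neg hl
  have h1 := algebraMap_multiP a ha (twoRow k l h) n
  rw [hp] at h1
  exact h1.trans (schurSum_two a n [k, l].get (genericPoint_injective n) genericPoint_add_ne_zero)

/-- The two-row functions in `n` variables, by one formula for all `k, l ≥ 0`. -/
theorem ratComponent_multiP₂ (a : ℕ → ℂ) (ha : a 1 = 0) (n k l : ℕ) :
    ratComponent n (multiP₂ a ha k l) =
      ∑ i, ∑ j, cayleyWeight (genericPoint n) i * cayleyWeight (genericPoint n) j *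
      ((genericPoint n j - genericPoint n i) / (genericPoint n i + genericPoint n j)) *
        (genPowPos a (genericPoint n i) k * genPowPos a (genericPoint n j) l) +
      ∑ i, cayleyWeight (genericPoint n) i *
        (genPowPos a (genericPoint n i) k * (if l = 0 then 1 else 0) -
          (if k = 0 then 1 else 0) * genPowPos a (genericPoint n i) l) := by
  -- The double sum is switched off when `k` or `l` is `0`, and the single sum then supplies the
  -- one-row function. Taking `(x|a)^0 = 1` in the double sum instead would fail for odd `n`: at `l
  -- = 0` it multiplies the one-row function by `1 - ∑ w_j`, and `∑ w_j` is `1` for odd `n` and `0`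
  -- for even `n`.
  set R := fun k l => ∑ i, ∑ j, cayleyWeight (genericPoint n) i * cayleyWeight (genericPoint n) j *
      ((genericPoint n j - genericPoint n i) / (genericPoint n i + genericPoint n j)) *
        (genPowPos a (genericPoint n i) k * genPowPos a (genericPoint n j) l) +
      ∑ i, cayleyWeight (genericPoint n) i *
        (genPowPos a (genericPoint n i) k * (if l = 0 then 1 else 0) -
          (if k = 0 then 1 else 0) * genPowPos a (genericPoint n i) l) with hR
  change _ = R k l
  -- Antisymmetry reduces everything to `l < k`; on the diagonal it forces `R k k = 0` in
  -- characteristic zero.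
  have hanti : ∀ k l, R k l = -R l k := by
    intro k l
    simp only [hR, neg_add, ← Finset.sum_neg_distrib]
    congr 1
    · rw [Finset.sum_comm]
      refine Finset.sum_congr rfl fun i _ => Finset.sum_congr rfl fun j _ => ?_
      rw [← neg_sub, add_comm (genericPoint n j)]
      ring
    · refine Finset.sum_congr rfl fun i _ => ?_
      ring
  have hlt : ∀ k l (h : l < k), ratComponent n (multiP a ha (twoRow k l h)) = R k l := by
    intro k l h
    have hk : k ≠ 0 := by omega
    rcases eq_or_ne l 0 with rfl | hl
    · rw [ratComponent_multiP_one]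
      simp [hR, genPowPos, hk, mul_comm]
    · rw [ratComponent_multiP_two a ha n hl h]
      simp [hR, genPowPos, hk, hl]
  rcases lt_trichotomy k l with h | rfl | h
  · rw [multiP₂, dif_neg h.not_gt, dif_pos h, map_neg, hlt, hanti k l]
  · have : CharZero (FractionRing (MvPolynomial (Fin n) ℂ)) :=
      charZero_of_injective_algebraMap (algebraMap ℂ _).injective
    rw [multiP₂, dif_neg (lt_irrefl k), dif_neg (lt_irrefl k), map_zero]
    exact (self_eq_neg.1 (hanti k k)).symm
  · rw [multiP₂, dif_pos h, hlt]

/-! ### Expansions in `T = u⁻¹` -/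

/-- The geometric series `1 / (1 - x T)`. -/
def geomSeries {A : Type*} [CommRing A] (x : A) : PowerSeries A := PowerSeries.mk fun m => x ^ m

theorem one_sub_mul_geomSeries {A : Type*} [CommRing A] (x : A) :
    (1 - PowerSeries.C x * PowerSeries.X) * geomSeries x = 1 := by
  ext m
  rw [sub_mul, one_mul, map_sub, mul_assoc, PowerSeries.coeff_C_mul, geomSeries]
  cases m with
  | zero => simp
  | succ m => simp [PowerSeries.coeff_succ_X_mul, PowerSeries.coeff_one, pow_succ']

theorem map_geomSeries {A B : Type*} [CommRing A] [CommRing B] (φ : A →+* B) (x : A) :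
    PowerSeries.map φ (geomSeries x) = geomSeries (φ x) := by
  ext m; simp [geomSeries]

/-- The expansion of `1 / (u | a)^k` in `T = u⁻¹`. -/
def invGenPow (A : Type*) [CommRing A] [Algebra ℂ A] (a : ℕ → ℂ) (k : ℕ) : PowerSeries A :=
  PowerSeries.X ^ k * ∏ i ∈ Finset.Icc 1 k, geomSeries (algebraMap ℂ A (a i))

theorem genPow_succ {A : Type*} [CommRing A] [Algebra ℂ A] (a : ℕ → ℂ) (x : A) (k : ℕ) :
    genPow a x (k + 1) = genPow a x k * (x - algebraMap ℂ A (a (k + 1))) :=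
  Finset.prod_Icc_succ_top (by omega) _

theorem invGenPow_zero (A : Type*) [CommRing A] [Algebra ℂ A] (a : ℕ → ℂ) :
    invGenPow A a 0 = 1 := by
  simp [invGenPow]

theorem invGenPow_succ (A : Type*) [CommRing A] [Algebra ℂ A] (a : ℕ → ℂ) (k : ℕ) :
    (1 - PowerSeries.C (algebraMap ℂ A (a (k + 1))) * PowerSeries.X) * invGenPow A a (k + 1) =
      PowerSeries.X * invGenPow A a k := by
  rw [invGenPow, invGenPow, Finset.prod_Icc_succ_top (by omega)]
  linear_combination PowerSeries.X ^ (k + 1) *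
    (∏ i ∈ Finset.Icc 1 k, geomSeries (algebraMap ℂ A (a i))) *
    one_sub_mul_geomSeries (algebraMap ℂ A (a (k + 1)))

theorem invGenPow_one (A : Type*) [CommRing A] [Algebra ℂ A] {a : ℕ → ℂ} (ha : a 1 = 0) :
    invGenPow A a 1 = PowerSeries.X := by
  simpa [invGenPow_zero, ha] using invGenPow_succ A a 0

theorem map_invGenPow {A B : Type*} [CommRing A] [Algebra ℂ A] [CommRing B] [Algebra ℂ B]
    (φ : A →+* B) (hφ : ∀ c : ℂ, φ (algebraMap ℂ A c) = algebraMap ℂ B c) (a : ℕ → ℂ) (k : ℕ) :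
    PowerSeries.map φ (invGenPow A a k) = invGenPow B a k := by
  simp [invGenPow, map_prod, map_geomSeries, hφ]

theorem coeff_invGenPow_of_lt {A : Type*} [CommRing A] [Algebra ℂ A] (a : ℕ → ℂ) {p k : ℕ}
    (h : p < k) : PowerSeries.coeff p (invGenPow A a k) = 0 := by
  rw [invGenPow, PowerSeries.coeff_X_pow_mul', if_neg h.not_ge]

/-- Telescoping: writing `u - y = (u - a_{k+1}) - (y - a_{k+1})` gives `(u - y)(y|a)^k/(u|a)^{k+1} =
(y|a)^k/(u|a)^k - (y|a)^{k+1}/(u|a)^{k+1}`. -/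
theorem sum_range_genPow_mul {A : Type*} [CommRing A] [Algebra ℂ A] (a : ℕ → ℂ) (y : A) (N : ℕ) :
    (1 - PowerSeries.C y * PowerSeries.X) *
        ∑ k ∈ Finset.range N, PowerSeries.C (genPow a y k) * invGenPow A a (k + 1) =
      PowerSeries.X * (1 - PowerSeries.C (genPow a y N) * invGenPow A a N) := by
  induction N with
  | zero => simp [genPow, invGenPow_zero]
  | succ N ih =>
    rw [Finset.sum_range_succ, mul_add, ih, genPow_succ, map_mul, map_sub]
    linear_combination PowerSeries.C (genPow a y N) * invGenPow_succ A a N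

/-- The coefficients of `1 / (u - y) = ∑ (y | a)^k / (u | a)^{k+1}`. -/
theorem coeff_X_mul_geomSeries {A : Type*} [CommRing A] [Algebra ℂ A] (a : ℕ → ℂ) (y : A)
    (p : ℕ) : PowerSeries.coeff p (PowerSeries.X * geomSeries y) =
      ∑ k ∈ Finset.range p, genPow a y k * PowerSeries.coeff p (invGenPow A a (k + 1)) := by
  -- The remainder after `p` terms is divisible by `T^{p+1}`, hence invisible in the coefficient of
  -- `T^p`.
  have h : ∑ k ∈ Finset.range p, PowerSeries.C (genPow a y k) * invGenPow A a (k + 1) =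
      PowerSeries.X * geomSeries y - PowerSeries.X ^ (p + 1) * (geomSeries y *
        PowerSeries.C (genPow a y p) *
        ∏ i ∈ Finset.Icc 1 p, geomSeries (algebraMap ℂ A (a i))) := by
    have h1 := sum_range_genPow_mul a y p
    have h2 := one_sub_mul_geomSeries y
    rw [show invGenPow A a p = PowerSeries.X ^ p * ∏ i ∈ Finset.Icc 1 p,
      geomSeries (algebraMap ℂ A (a i)) from rfl] at h1
    linear_combination geomSeries y * h1 -
      (∑ k ∈ Finset.range p, PowerSeries.C (genPow a y k) * invGenPow A a (k + 1)) * h2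
  have h3 := congrArg (PowerSeries.coeff p) h
  rw [map_sub, PowerSeries.coeff_X_pow_mul', if_neg (by omega), sub_zero, map_sum] at h3
  simp only [← h3, PowerSeries.coeff_C_mul]

theorem sum_range_ite_mul_coeff_invGenPow {A : Type*} [CommRing A] [Algebra ℂ A] {a : ℕ → ℂ}
    (ha : a 1 = 0) (p : ℕ) :
    ∑ k ∈ Finset.range p, (if k = 0 then 1 else 0) * PowerSeries.coeff p (invGenPow A a (k + 1)) =
      PowerSeries.coeff p PowerSeries.X := by
  cases p with
  | zero => simp
  | succ p => simp [invGenPow_one A ha]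

/-- Omitting `k = 0` subtracts `1/(u|a)^1`, which is `1/u = T` because `a_1 = 0`; the result is the
expansion of `1/(u - y) - 1/u`. -/
theorem sum_range_genPowPos_mul_coeff_invGenPow {A : Type*} [CommRing A] [Algebra ℂ A]
    {a : ℕ → ℂ} (ha : a 1 = 0) (y : A) (p : ℕ) :
    ∑ k ∈ Finset.range p, genPowPos a y k * PowerSeries.coeff p (invGenPow A a (k + 1)) =
      PowerSeries.coeff p (PowerSeries.X * geomSeries y - PowerSeries.X) := by
  rw [map_sub, ← sum_range_ite_mul_coeff_invGenPow ha, coeff_X_mul_geomSeries a,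
    ← Finset.sum_sub_distrib]
  refine Finset.sum_congr rfl fun k _ => ?_
  rcases eq_or_ne k 0 with rfl | hk
  · simp [genPowPos, genPow]
  · simp [genPowPos, hk]

/-! ### Series in two variables -/

theorem coeff_substU {R : Type*} [CommRing R] (f : PowerSeries R) (p : ℕ) :
    (substU R f).coeff ((p : ℤ), 0) = PowerSeries.coeff p f :=
  (HahnSeries.embDomain_mk_coeff (f := (AddMonoidHom.inl ℤ ℤ).comp (Nat.castAddMonoidHom ℤ))
    _ _).trans (by simp)

theorem coeff_substV {R : Type*} [CommRing R] (f : PowerSeries R) (p : ℕ) :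
    (substV R f).coeff (0, (p : ℤ)) = PowerSeries.coeff p f :=
  (HahnSeries.embDomain_mk_coeff (f := (AddMonoidHom.inr ℤ ℤ).comp (Nat.castAddMonoidHom ℤ))
    _ _).trans (by simp)

theorem exists_of_coeff_substU_ne_zero {R : Type*} [CommRing R] {f : PowerSeries R} {g : ℤ × ℤ}
    (h : (substU R f).coeff g ≠ 0) : ∃ p : ℕ, g = ((p : ℤ), 0) := by
  contrapose! h
  refine HahnSeries.embDomain_of_notMem_range ?_
  rintro ⟨m, hm⟩
  exact h m hm.symm

theorem exists_of_coeff_substV_ne_zero {R : Type*} [CommRing R] {f : PowerSeries R} {g : ℤ × ℤ}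
    (h : (substV R f).coeff g ≠ 0) : ∃ p : ℕ, g = (0, (p : ℤ)) := by
  contrapose! h
  refine HahnSeries.embDomain_of_notMem_range ?_
  rintro ⟨m, hm⟩
  exact h m hm.symm

/-- The supports of the two factors lie on different coordinate axes, so each exponent arises from
at most one pair. -/
theorem coeff_substU_mul_substV {R : Type*} [CommRing R] (f g : PowerSeries R) (x : ℤ × ℤ) :
    (substU R f * substV R g).coeff x =
      (substU R f).coeff (x.1, 0) * (substV R g).coeff (0, x.2) := by
  rw [HahnSeries.coeff_mul]
  refine Finset.sum_eq_single ((x.1, 0), (0, x.2)) (fun ij hij hne => ?_) fun hn => ?_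
  · by_contra h
    obtain ⟨p, hp⟩ := exists_of_coeff_substU_ne_zero (left_ne_zero_of_mul h)
    obtain ⟨q, hq⟩ := exists_of_coeff_substV_ne_zero (right_ne_zero_of_mul h)
    apply hne
    have hx : ij.1 + ij.2 = x := (Finset.mem_antidiagonal.1 hij).2.2
    rw [← hx]
    ext <;> simp [hp, hq]
  · by_contra h
    exact hn (Finset.mem_antidiagonal.2 ⟨left_ne_zero_of_mul h, right_ne_zero_of_mul h, by simp⟩)

theorem coeff_C_mul_substU_mul_substV {R : Type*} [CommRing R] (c : R) (f g : PowerSeries R)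
    (p q : ℕ) : (HahnSeries.C c * (substU R f * substV R g)).coeff ((p : ℤ), (q : ℤ)) =
      c * (PowerSeries.coeff p f * PowerSeries.coeff q g) := by
  rw [HahnSeries.C_mul_eq_smul, HahnSeries.coeff_smul, coeff_substU_mul_substV, coeff_substU,
    coeff_substV, smul_eq_mul]

theorem coeff_C_mul_substU_mul_substV_eq_zero {R : Type*} [CommRing R] (c : R)
    (f g : PowerSeries R) {x : ℤ × ℤ} (hx : ∀ p q : ℕ, x ≠ ((p : ℤ), (q : ℤ))) :
    (HahnSeries.C c * (substU R f * substV R g)).coeff x = 0 := by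
  rw [HahnSeries.C_mul_eq_smul, HahnSeries.coeff_smul, coeff_substU_mul_substV]
  by_contra h
  have h' := right_ne_zero_of_smul h
  obtain ⟨p, hp⟩ := exists_of_coeff_substU_ne_zero (left_ne_zero_of_mul h')
  obtain ⟨q, hq⟩ := exists_of_coeff_substV_ne_zero (right_ne_zero_of_mul h')
  simp only [Prod.mk.injEq, and_true, true_and] at hp hq
  exact hx p q (Prod.ext hp hq)

/-- Identifies the explicit expansion with the abstract `Ring.inverse` in the main statement. -/
theorem genPow_varU_mul {R : Type*} [CommRing R] [Algebra ℂ R] (a : ℕ → ℂ) (k : ℕ) :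
    genPow a (varU R) k * substU R (invGenPow R a k) = 1 := by
  induction k with
  | zero => simp [genPow, invGenPow_zero]
  | succ k ih =>
    have h := congrArg (substU R) (invGenPow_succ R a k)
    rw [map_mul, map_mul] at h
    rw [genPow_succ, show algebraMap ℂ (LSeries₂ R) (a (k + 1)) =
      HahnSeries.C (algebraMap ℂ R (a (k + 1))) from rfl, varU_sub_C]
    linear_combination genPow a (varU R) k * varU R * h + ih +
      genPow a (varU R) k * substU R (invGenPow R a k) * varU_mul_substU_X R

theorem genPow_varV_mul {R : Type*} [CommRing R] [Algebra ℂ R] (a : ℕ → ℂ) (k : ℕ) :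
    genPow a (varV R) k * substV R (invGenPow R a k) = 1 := by
  induction k with
  | zero => simp [genPow, invGenPow_zero]
  | succ k ih =>
    have h := congrArg (substV R) (invGenPow_succ R a k)
    rw [map_mul, map_mul] at h
    rw [genPow_succ, show algebraMap ℂ (LSeries₂ R) (a (k + 1)) =
      HahnSeries.C (algebraMap ℂ R (a (k + 1))) from rfl, varV_sub_C]
    linear_combination genPow a (varV R) k * varV R * h + ih +
      genPow a (varV R) k * substV R (invGenPow R a k) * varV_mul_substV_X R

theorem inverse_eq_of_mul_eq_one {R : Type*} [CommRing R] {x y : R} (h : x * y = 1) :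
    Ring.inverse x = y := by
  rw [← mul_one (Ring.inverse x), ← h,
    Ring.inverse_mul_cancel_left _ _ (IsUnit.of_mul_eq_one _ h)]

/-- Coefficientwise application of a ring homomorphism. -/
def mapLSeries {R S : Type*} [CommRing R] [CommRing S] (φ : R →+* S) :
    LSeries₂ R →+* LSeries₂ S where
  toFun x := x.map φ
  map_one' := HahnSeries.map_one φ.toMonoidWithZeroHom
  map_mul' _ _ := HahnSeries.map_mul φ.toNonUnitalRingHom
  map_zero' := by ext; simp
  map_add' _ _ := by ext; simp

/-- The expansion of `1/(u|a)^{k+1}` starts at `u^{-(k+1)}`, so only `k < p` and `l < q` contribute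
to `u^{-p} v^{-q}`. This is the finiteness behind the double sum. -/
theorem mem_range_of_coeff_ne_zero {R : Type*} [CommRing R] [Algebra ℂ R] {a : ℕ → ℂ} {c : R}
    {p q k l : ℕ} (h : (HahnSeries.C c * (substU R (invGenPow R a (k + 1)) *
      substV R (invGenPow R a (l + 1)))).coeff ((p : ℤ), (q : ℤ)) ≠ 0) :
    (k, l) ∈ Finset.range p ×ˢ Finset.range q := by
  rw [coeff_C_mul_substU_mul_substV] at h
  rw [Finset.mem_product, Finset.mem_range, Finset.mem_range]
  constructor
  · by_contra hp
    exact h (by rw [coeff_invGenPow_of_lt a (by omega), zero_mul, mul_zero])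
  · by_contra hq
    exact h (by rw [coeff_invGenPow_of_lt (k := l + 1) a (by omega), mul_zero, mul_zero])

/-- The generating function of the two-row functions, as a summable family. -/
def twoRowFamily (a : ℕ → ℂ) (ha : a 1 = 0) : HahnSeries.SummableFamily (ℤ × ℤ) Gamma (ℕ × ℕ) where
  toFun kl := HahnSeries.C (multiP₂ a ha kl.1 kl.2) *
    (substU Gamma (invGenPow Gamma a (kl.1 + 1)) * substV Gamma (invGenPow Gamma a (kl.2 + 1)))
  isPWO_iUnion_support' := by
    -- All supports lie in the image of `ℕ × ℕ`, which is well quasi-ordered.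
    have hm : Monotone fun pq : ℕ × ℕ => ((pq.1 : ℤ), (pq.2 : ℤ)) := fun x y h =>
      ⟨Int.ofNat_le.2 h.1, Int.ofNat_le.2 h.2⟩
    refine ((Set.isPWO_of_wellQuasiOrderedLE Set.univ).image_of_monotone hm).mono ?_
    refine Set.iUnion_subset fun kl x hx => ?_
    by_contra h
    refine hx (coeff_C_mul_substU_mul_substV_eq_zero _ _ _ fun p q e => h ?_)
    exact ⟨(p, q), Set.mem_univ _, e.symm⟩
  finite_co_support' x := by
    by_cases h : ∃ p q : ℕ, x = ((p : ℤ), (q : ℤ))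
    · obtain ⟨p, q, rfl⟩ := h
      exact (Finset.range p ×ˢ Finset.range q).finite_toSet.subset fun kl hkl =>
        mem_range_of_coeff_ne_zero hkl
    · push Not at h
      convert Set.finite_empty
      ext kl
      simpa using coeff_C_mul_substU_mul_substV_eq_zero _ _ _ h

theorem coeff_hsum_twoRowFamily (a : ℕ → ℂ) (ha : a 1 = 0) (p q : ℕ) :
    (twoRowFamily a ha).hsum.coeff ((p : ℤ), (q : ℤ)) =
      ∑ k ∈ Finset.range p, ∑ l ∈ Finset.range q, multiP₂ a ha k l *
        (PowerSeries.coeff p (invGenPow Gamma a (k + 1)) *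
          PowerSeries.coeff q (invGenPow Gamma a (l + 1))) := by
  rw [HahnSeries.SummableFamily.coeff_hsum_eq_sum_of_subset
    (t := Finset.range p ×ˢ Finset.range q), Finset.sum_product]
  · exact Finset.sum_congr rfl fun k _ => Finset.sum_congr rfl fun l _ =>
      coeff_C_mul_substU_mul_substV _ _ _ _ _
  · exact fun kl hkl => mem_range_of_coeff_ne_zero hkl

/-! ### The generating function in `n` variables -/

theorem sum_sum_sum_sum_comm {M ι κ : Type*} [AddCommMonoid M] (s t : Finset ι) (s' t' : Finset κ)
    (f : ι → ι → κ → κ → M) :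
    ∑ k ∈ s, ∑ l ∈ t, ∑ i ∈ s', ∑ j ∈ t', f k l i j =
      ∑ i ∈ s', ∑ j ∈ t', ∑ k ∈ s, ∑ l ∈ t, f k l i j := by
  rw [Finset.sum_congr rfl fun k _ => Finset.sum_comm, Finset.sum_comm]
  refine Finset.sum_congr rfl fun i _ => ?_
  rw [Finset.sum_congr rfl fun k _ => Finset.sum_comm, Finset.sum_comm]

theorem LSeries₂_ext_of_coeff_nat {R : Type*} [Zero R] {x y : LSeries₂ R}
    (h : ∀ p q : ℕ, x.coeff ((p : ℤ), (q : ℤ)) = y.coeff ((p : ℤ), (q : ℤ)))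
    (hx : ∀ g, (∀ p q : ℕ, g ≠ ((p : ℤ), (q : ℤ))) → x.coeff g = 0)
    (hy : ∀ g, (∀ p q : ℕ, g ≠ ((p : ℤ), (q : ℤ))) → y.coeff g = 0) : x = y := by
  ext g
  by_cases hg : ∀ p q : ℕ, g ≠ ((p : ℤ), (q : ℤ))
  · rw [hx g hg, hy g hg]
  · push Not at hg
    obtain ⟨p, q, rfl⟩ := hg
    exact h p q

/-- At each exponent the sum over `k, l` is finite and can be moved inside the sums over `i, j`. It
then factors into one-variable series, `1/(u - y_i) - 1/u` from positive rows and `1/u` from a zero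
row, and likewise in `v`. -/
theorem map_hsum_twoRowFamily (a : ℕ → ℂ) (ha : a 1 = 0) (n : ℕ) :
    mapLSeries (ratComponent n) (twoRowFamily a ha).hsum =
      ∑ i, ∑ j, HahnSeries.C (cayleyWeight (genericPoint n) i * cayleyWeight (genericPoint n) j *
          ((genericPoint n j - genericPoint n i) / (genericPoint n i + genericPoint n j))) *
        (substU _ (PowerSeries.X * geomSeries (genericPoint n i) - PowerSeries.X) *
          substV _ (PowerSeries.X * geomSeries (genericPoint n j) - PowerSeries.X)) +
      ∑ i, (HahnSeries.C (cayleyWeight (genericPoint n) i) *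
          (substU _ (PowerSeries.X * geomSeries (genericPoint n i) - PowerSeries.X) *
            substV _ PowerSeries.X) -
        HahnSeries.C (cayleyWeight (genericPoint n) i) *
          (substU _ PowerSeries.X *
            substV _ (PowerSeries.X * geomSeries (genericPoint n i) - PowerSeries.X))) := by
  have hinv : ∀ p k : ℕ, ratComponent n (PowerSeries.coeff p (invGenPow Gamma a k)) =
      PowerSeries.coeff p (invGenPow (FractionRing (MvPolynomial (Fin n) ℂ)) a k) := fun p k => by
    rw [← PowerSeries.coeff_map, map_invGenPow]
    exact fun c => ((IsScalarTower.algebraMap_apply ℂ (MvPolynomial (Fin n) ℂ) _ c)).symm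
  refine LSeries₂_ext_of_coeff_nat (fun p q => ?_) (fun g hg => ?_) fun g hg => ?_
  · simp only [HahnSeries.coeff_add, HahnSeries.coeff_sum, HahnSeries.coeff_sub,
      coeff_C_mul_substU_mul_substV]
    refine (congrArg (ratComponent n) (coeff_hsum_twoRowFamily a ha p q)).trans ?_
    simp only [map_sum, map_mul, hinv, ratComponent_multiP₂,
      ← sum_range_genPowPos_mul_coeff_invGenPow ha,
      ← sum_range_ite_mul_coeff_invGenPow (A := FractionRing (MvPolynomial (Fin n) ℂ)) ha,
      add_mul, Finset.sum_add_distrib, Finset.sum_mul, Finset.mul_sum]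
    congr 1
    · rw [sum_sum_sum_sum_comm]
      refine Finset.sum_congr rfl fun i _ => Finset.sum_congr rfl fun j _ => ?_
      rw [Finset.sum_comm]
      refine Finset.sum_congr rfl fun l _ => Finset.sum_congr rfl fun k _ => ?_
      ring
    · rw [Finset.sum_congr rfl fun k _ => Finset.sum_comm, Finset.sum_comm]
      refine Finset.sum_congr rfl fun i _ => ?_
      rw [Finset.sum_comm]
      simp only [← Finset.sum_sub_distrib]
      refine Finset.sum_congr rfl fun l _ => Finset.sum_congr rfl fun k _ => ?_
      ring
  · refine (congrArg (ratComponent n) ?_).trans (map_zero _)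
    rw [HahnSeries.SummableFamily.coeff_hsum]
    exact finsum_eq_zero_of_forall_eq_zero fun kl =>
      coeff_C_mul_substU_mul_substV_eq_zero _ _ _ hg
  · simp only [HahnSeries.coeff_add, HahnSeries.coeff_sum, HahnSeries.coeff_sub,
      coeff_C_mul_substU_mul_substV_eq_zero _ _ _ hg, Finset.sum_const_zero, sub_zero, add_zero]

/-! ### Passage from Γ to rational functions in `n` variables, and the identity there -/

theorem mapLSeries_single {R S : Type*} [CommRing R] [CommRing S] (φ : R →+* S) (g : ℤ × ℤ) :
    mapLSeries φ (HahnSeries.single g 1) = HahnSeries.single g 1 :=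
  (HahnSeries.map_single φ.toZeroHom).trans (congrArg _ (map_one φ))

/-- An element of Γ is the sequence of its components, and polynomials embed in rational functions.
The fraction field is needed because the weights `w_i` are not polynomials. -/
theorem mapLSeries_injective {x y : LSeries₂ Gamma}
    (h : ∀ n, mapLSeries (ratComponent n) x = mapLSeries (ratComponent n) y) : x = y := by
  ext1
  funext g
  refine Subtype.ext (funext fun n => ?_)
  exact IsFractionRing.injective (MvPolynomial (Fin n) ℂ) _
    (congrArg (fun z => HahnSeries.coeff z g) (h n))

theorem map_ratComponent_infProd (n : ℕ) :
    PowerSeries.map (ratComponent n) infProd = ∏ j, cayley (genericPoint n j) := by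
  rw [ratComponent, PowerSeries.map_comp, RingHom.comp_apply, map_component_infProd,
    map_cayleyProd]
  rfl

theorem varU_sub_mul_substU_geomSeries {K : Type*} [CommRing K] (y : K) :
    (varU K - HahnSeries.C y) * substU K (PowerSeries.X * geomSeries y) = 1 := by
  have h := congrArg (substU K) (one_sub_mul_geomSeries y)
  rw [map_mul, map_one] at h
  rw [varU_sub_C, map_mul]
  linear_combination varU K * substU K PowerSeries.X * h + varU_mul_substU_X K

theorem varV_sub_mul_substV_geomSeries {K : Type*} [CommRing K] (y : K) :
    (varV K - HahnSeries.C y) * substV K (PowerSeries.X * geomSeries y) = 1 := by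
  have h := congrArg (substV K) (one_sub_mul_geomSeries y)
  rw [map_mul, map_one] at h
  rw [varV_sub_C, map_mul]
  linear_combination varV K * substV K PowerSeries.X * h + varV_mul_substV_X K

theorem substU_prod_cayley_mul {K : Type*} [CommRing K] {n : ℕ} (y : Fin n → K) :
    substU K (∏ j, cayley (y j)) * ∏ j, (varU K - HahnSeries.C (y j)) =
      ∏ j, (varU K + HahnSeries.C (y j)) := by
  rw [map_prod, ← Finset.prod_mul_distrib]
  refine Finset.prod_congr rfl fun j _ => ?_
  have h := varU_sub_C (-y j)
  simp only [map_neg, sub_neg_eq_add, neg_mul] at h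
  rw [varU_sub_C, mul_left_comm, ← map_mul, cayley_mul, h]

theorem substV_prod_cayley_mul {K : Type*} [CommRing K] {n : ℕ} (y : Fin n → K) :
    substV K (∏ j, cayley (y j)) * ∏ j, (varV K - HahnSeries.C (y j)) =
      ∏ j, (varV K + HahnSeries.C (y j)) := by
  rw [map_prod, ← Finset.prod_mul_distrib]
  refine Finset.prod_congr rfl fun j _ => ?_
  have h := varV_sub_C (-y j)
  simp only [map_neg, sub_neg_eq_add, neg_mul] at h
  rw [varV_sub_C, mul_left_comm, ← map_mul, cayley_mul, h]

/-- With `u' = 1/u`, `v' = 1/v`, `F = 1 + A` and `G = 1 + B`, the right side is `(v - u)AB + 2vA -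
2uB`. On the left, `4uv` turns the double sum into the one of `add_mul_sum_cayleyWeight` (`h1`) and
the single sum into `2A - 2B` (`h2`). -/
theorem two_row_identity {K L : Type*} [Field K] [CommRing L] [Algebra K L] {n : ℕ}
    {y : Fin n → K} (hy : Function.Injective y) (hs : ∀ i j, y i + y j ≠ 0)
    {u v u' v' F G : L} {U V : Fin n → L} (hu : u * u' = 1) (hv : v * v' = 1)
    (hU : ∀ i, (u - algebraMap K L (y i)) * U i = 1)
    (hV : ∀ i, (v - algebraMap K L (y i)) * V i = 1)
    (hF : F * ∏ j, (u - algebraMap K L (y j)) = ∏ j, (u + algebraMap K L (y j)))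
    (hG : G * ∏ j, (v - algebraMap K L (y j)) = ∏ j, (v + algebraMap K L (y j))) :
    4 * u * v * (u + v) *
      (∑ i, ∑ j, algebraMap K L (cayleyWeight y i * cayleyWeight y j *
          ((y j - y i) / (y i + y j))) * ((U i - u') * (V j - v')) +
        ∑ i, (algebraMap K L (cayleyWeight y i) * ((U i - u') * v') -
          algebraMap K L (cayleyWeight y i) * (u' * (V i - v')))) =
      u * (F + 1) * (-G + 1) - v * (-F + 1) * (G + 1) := by
  have hq := add_mul_sum_cayleyWeight hy hs hU hV fun _ => rfl
  rw [eq_one_add_sum_cayleyWeight hy hU hF, eq_one_add_sum_cayleyWeight hy hV hG]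
  have hUu : ∀ i, u * (U i - u') = algebraMap K L (y i) * U i := fun i => by
    linear_combination hU i - hu
  have hVv : ∀ i, v * (V i - v') = algebraMap K L (y i) * V i := fun i => by
    linear_combination hV i - hv
  have h1 : 4 * u * v * ∑ i, ∑ j, algebraMap K L (cayleyWeight y i * cayleyWeight y j *
      ((y j - y i) / (y i + y j))) * ((U i - u') * (V j - v')) =
      ∑ i, ∑ j, algebraMap K L ((2 * y i * cayleyWeight y i) * (2 * y j * cayleyWeight y j) *
        ((y j - y i) / (y i + y j))) * (U i * V j) := by
    simp only [Finset.mul_sum]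
    refine Finset.sum_congr rfl fun i _ => Finset.sum_congr rfl fun j _ => ?_
    simp only [map_mul, map_ofNat]
    linear_combination 4 * algebraMap K L (cayleyWeight y i) * algebraMap K L (cayleyWeight y j) *
      algebraMap K L ((y j - y i) / (y i + y j)) *
      (v * (V j - v') * hUu i + algebraMap K L (y i) * U i * hVv j)
  have h2 : 4 * u * v * ∑ i, (algebraMap K L (cayleyWeight y i) * ((U i - u') * v') -
      algebraMap K L (cayleyWeight y i) * (u' * (V i - v'))) =
      2 * ∑ i, algebraMap K L (2 * y i * cayleyWeight y i) * U i -
        2 * ∑ i, algebraMap K L (2 * y i * cayleyWeight y i) * V i := by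
    simp only [Finset.mul_sum, ← Finset.sum_sub_distrib]
    refine Finset.sum_congr rfl fun i _ => ?_
    simp only [map_mul, map_ofNat]
    linear_combination 4 * algebraMap K L (cayleyWeight y i) *
      (v * v' * hUu i + algebraMap K L (y i) * U i * hv - u * u' * hVv i -
        algebraMap K L (y i) * V i * hu)
  linear_combination (u + v) * h1 + (u + v) * h2 + hq

theorem two_row_identity_LSeries {K : Type*} [Field K] {n : ℕ} {y : Fin n → K}
    (hy : Function.Injective y) (hs : ∀ i j, y i + y j ≠ 0) :
    4 * varU K * varV K * (varU K + varV K) *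
      (∑ i, ∑ j, HahnSeries.C (cayleyWeight y i * cayleyWeight y j *
          ((y j - y i) / (y i + y j))) *
        (substU K (PowerSeries.X * geomSeries (y i) - PowerSeries.X) *
          substV K (PowerSeries.X * geomSeries (y j) - PowerSeries.X)) +
      ∑ i, (HahnSeries.C (cayleyWeight y i) *
          (substU K (PowerSeries.X * geomSeries (y i) - PowerSeries.X) *
            substV K PowerSeries.X) -
        HahnSeries.C (cayleyWeight y i) * (substU K PowerSeries.X *
            substV K (PowerSeries.X * geomSeries (y i) - PowerSeries.X)))) =
      varU K * (substU K (∏ j, cayley (y j)) + 1) * (-substV K (∏ j, cayley (y j)) + 1) -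
        varV K * (-substU K (∏ j, cayley (y j)) + 1) * (substV K (∏ j, cayley (y j)) + 1) := by
  -- Constant series are the algebra map by definition, which puts the hypotheses in the form
  -- required over a general `K`-algebra.
  have hC : ∀ x : K, HahnSeries.C x = algebraMap K (LSeries₂ K) x := fun _ => rfl
  have hU := fun i => varU_sub_mul_substU_geomSeries (y i)
  have hV := fun i => varV_sub_mul_substV_geomSeries (y i)
  have hF := substU_prod_cayley_mul y
  have hG := substV_prod_cayley_mul y
  simp only [hC] at hU hV hF hG ⊢
  simp only [map_sub (substU K), map_sub (substV K)]
  exact two_row_identity hy hs (varU_mul_substU_X K) (varV_mul_substV_X K) hU hV hF hG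

end

end MultiSchur

/-! ### The generating function over Γ -/

open MultiSchur
-- The infinite double sum is expressed by a summable family whose members are prescribed; existence
-- of the family contains the convergence, and its sum is determined by the members.
theorem mainTheorem11 (a : ℕ → ℂ) (ha : a 1 = 0) :
    ∃ s : HahnSeries.SummableFamily (ℤ × ℤ) Gamma (ℕ × ℕ),
      (∀ k l : ℕ, s (k, l) = HahnSeries.C (multiP₂ a ha k l) *
        Ring.inverse (genPow a (varU Gamma) (k + 1)) *
        Ring.inverse (genPow a (varV Gamma) (l + 1))) ∧
      4 * varU Gamma * varV Gamma * (varU Gamma + varV Gamma) * s.hsum =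
        varU Gamma * (prodU + 1) * (-prodV + 1) - varV Gamma * (-prodU + 1) * (prodV + 1) := by
  refine ⟨twoRowFamily a ha, fun k l => ?_, mapLSeries_injective fun n => ?_⟩
  · rw [inverse_eq_of_mul_eq_one (genPow_varU_mul a (k + 1)),
      inverse_eq_of_mul_eq_one (genPow_varV_mul a (l + 1)), mul_assoc]
    rfl
  -- Each ingredient is carried to `n` variables, where the products over all `x_j` become finite
  -- products at the generic point.
  · have hu : mapLSeries (ratComponent n) (varU Gamma) = varU _ := mapLSeries_single _ _
    have hv : mapLSeries (ratComponent n) (varV Gamma) = varV _ := mapLSeries_single _ _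
    have hF : mapLSeries (ratComponent n) prodU = substU _ (∏ j, cayley (genericPoint n j)) := by
      rw [← map_ratComponent_infProd]
      exact map_substU _ _
    have hG : mapLSeries (ratComponent n) prodV = substV _ (∏ j, cayley (genericPoint n j)) := by
      rw [← map_ratComponent_infProd]
      exact map_substV _ _
    have h4 : mapLSeries (ratComponent n) 4 = 4 := map_ofNat _ 4
    simp only [map_mul (mapLSeries _), map_add (mapLSeries _), map_sub (mapLSeries _),
      map_neg (mapLSeries _), map_one (mapLSeries _), h4, hu, hv, hF, hG]
    rw [map_hsum_twoRowFamily]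
    exact two_row_identity_LSeries (genericPoint_injective n) genericPoint_add_ne_zero
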